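/- For $1\le p<\infty$ let $B^p=B^p(\mathbb R,\mathbb C)$ be the set of measurable functions $f:\mathbb R\to\mathbb C$ which are limits of trigonometric polynomials $\sum_{k=1}^n c_ke^{i\lambda_kt}$ ($\lambda_k\in\mathbb R$, $c_k\in\mathbb C$) in the Besicovitch seminorm $\|f\|_{B^p}=\left(\limsup_{l\to\infty}\frac1{2l}\int_{-l}^l|f(t)|^p\,dt\right)^{1/p}$, and write $B=B^1$. Let $M(g)=\lim_{l\to\infty}\frac1{2l}\int_{-l}^lg(t)\,dt$ denote the mean value. The Fourier coefficients of $f\in B$ are $a(f,\lambda)=M(f(t)e^{-i\lambda t})$, $\lambda\in\mathbb R$. Two functions $f_1,f_2\in B$ with Fourier series $\sum_{j\ge1}a_je^{i\lambda_jt}$ and $\sum_{j\ge1}b_je^{i\lambda_jt}$, written over a common finite or countably infinite set $\Lambda=\{\lambda_1,\lambda_2,\dots\}$ of distinct real exponents (zero coefficients are allowed, and all coefficients at $\lambda\notin\Lambda$ vanish), are called equivalent if for each integer $n\ge1$ with $n\le\sharp\Lambda$ there is a $\mathbb Q$-linear map $\psi_n:V_n\to\mathbb R$, where $V_n$ is the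 $\mathbb Q$-vector space spanned by $\lambda_1,\dots,\lambda_n$, such that $b_j=a_je^{i\psi_n(\lambda_j)}$ for $j=1,\dots,n$. A set $S$ of positive numbers is called satisfactorily uniform if for some $l>0$ the ratio of the maximum number of elements of $S$ in an interval $(a,a+l)$, $a\ge0$, to the minimum number is less than $2$ (in particular, the maximum is finite and the minimum is positive). Let $f\in B^2$ and let $f_1\in B$ be equivalent to $f$. Then $f_1$ represents an element of $B^2$, that is, there is $g\in B^2$ with $\|f_1-g\|_{B^1}=0$. Moreover, for every such $g$ (for $g=f_1$ itself, if $f_1\in B^2$): 1. There is a strictly increasing unbounded sequence $(\tau_n)_{n\ge1}$ of positive numbers such that $f(t+\tau_n)\to g(t)$ in $B^2$, i.e. $\|f(\cdot+\tau_n)-g\|_{B^2}\to0$. 2. For each $\varepsilon>0$ there is a satisfactorily uniform set $S$ of positive numbers such that for every $\tau\in S$ the mean value $M(|f(t+\tau)-g(t)|^2)$ exists and is less than $\varepsilon$. -/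

import Mathlib

open Filter Topology MeasureTheory
open scoped ENNReal

namespace Besicovitch

/-- A trigonometric polynomial `t ↦ ∑ c_x e^{ixt}` with finitely many real exponents `x`. -/
def IsTrigPoly (P : ℝ → ℂ) : Prop :=
  ∃ (s : Finset ℝ) (c : ℝ → ℂ),
    P = fun t : ℝ => ∑ x ∈ s, c x * Complex.exp (Complex.I * (x : ℂ) * (t : ℂ))

/-- The Besicovitch seminorm `(limsup_{l → ∞} (2l)⁻¹ ∫_{-l}^{l} |f(t)|^p dt)^{1/p}`,
with values in `[0, ∞]`. -/
noncomputable def seminorm (p : ℝ) (f : ℝ → ℂ) : ℝ≥0∞ :=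
  (limsup (fun l : ℝ =>
    (ENNReal.ofReal (2 * l))⁻¹ * ∫⁻ t in Set.Ioc (-l) l, ‖f t‖ₑ ^ p) atTop) ^ (1 / p)

/-- `f` belongs to the Besicovitch space `B^p(ℝ, ℂ)`: it is measurable and it is a limit of
trigonometric polynomials in the Besicovitch seminorm. (Local `p`-integrability follows,
since a finite upper mean forces the integrals over `[-l, l]` to be finite.)
The space `B(ℝ, ℂ)` is the case `p = 1`. -/
def MemB (p : ℝ) (f : ℝ → ℂ) : Prop :=
  AEStronglyMeasurable f volume ∧
    ∀ ε : ℝ≥0∞, 0 < ε → ∃ P : ℝ → ℂ, IsTrigPoly P ∧ seminorm p (fun t => f t - P t) < ε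

/-- The mean value `M(g) = lim_{l → ∞} (2l)⁻¹ ∫_{-l}^{l} g(t) dt` exists and equals `m`. -/
def HasMean {E : Type*} [NormedAddCommGroup E] [NormedSpace ℝ E] (g : ℝ → E) (m : E) : Prop :=
  LocallyIntegrable g volume ∧
    Tendsto (fun l : ℝ => (2 * l)⁻¹ • ∫ t in (-l)..l, g t) atTop (𝓝 m)

/-- The Fourier coefficient `a(f, x) = M(f(t) e^{-ixt})` exists and equals `a`. -/
def HasFourierCoeff (f : ℝ → ℂ) (x : ℝ) (a : ℂ) : Prop :=
  HasMean (fun t : ℝ => f t * Complex.exp (-(Complex.I * (x : ℂ) * (t : ℂ)))) a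

/-- The Fourier series of `f` is `∑_{j < N} a_j e^{i lam_j t}`, where `N ≤ ∞` is the number of
exponents (indexed from `0`): `a_j` is the Fourier coefficient of `f` at `lam_j`, and the
coefficients at all other real numbers vanish. Coefficients `a_j = 0` are allowed. -/
def HasFourierSeries (f : ℝ → ℂ) (N : ℕ∞) (lam : ℕ → ℝ) (a : ℕ → ℂ) : Prop :=
  (∀ j : ℕ, (j : ℕ∞) < N → HasFourierCoeff f (lam j) (a j)) ∧
    ∀ x : ℝ, (∀ j : ℕ, (j : ℕ∞) < N → lam j ≠ x) → HasFourierCoeff f x 0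

/-- Equivalence of the formal exponential sums with exponents `lam_j`, `j < N`, and coefficients
`a_j` and `b_j`: for each `1 ≤ n ≤ N` there is a `ℚ`-linear map `ψ : V_n → ℝ`, where `V_n` is
the `ℚ`-span of the first `n` exponents, with `b_j = a_j e^{i ψ(lam_j)}` for these exponents. -/
def ExpSumEquiv (N : ℕ∞) (lam : ℕ → ℝ) (a b : ℕ → ℂ) : Prop :=
  ∀ n : ℕ, 1 ≤ n → (n : ℕ∞) ≤ N →
    ∃ ψ : Submodule.span ℚ (lam '' Set.Iio n) →ₗ[ℚ] ℝ,
      ∀ (j : ℕ) (hj : j < n),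
        b j = a j * Complex.exp (Complex.I *
          ((ψ ⟨lam j, Submodule.subset_span (Set.mem_image_of_mem lam hj)⟩ : ℝ) : ℂ))

/-- Equivalence of two functions of `B(ℝ, ℂ)`: their Fourier series, written over a common
(finite or countably infinite) set of distinct exponents, are equivalent. -/
def BohrEquiv (f₁ f₂ : ℝ → ℂ) : Prop :=
  MemB 1 f₁ ∧ MemB 1 f₂ ∧
    ∃ (N : ℕ∞) (lam : ℕ → ℝ) (a b : ℕ → ℂ),
      Set.InjOn lam {j : ℕ | (j : ℕ∞) < N} ∧
      HasFourierSeries f₁ N lam a ∧ HasFourierSeries f₂ N lam b ∧ ExpSumEquiv N lam a b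

/-- `S` is a satisfactorily uniform set of numbers of `J`: `S ⊆ J` and, for some length `l > 0`,
the ratio of the maximum number of elements of `S` in an interval `(a, a + l) ⊆ J` to the minimum
number is less than `2` (so the maximum is finite and the minimum is positive). -/
def IsSatisfactorilyUniform (S J : Set ℝ) : Prop :=
  S ⊆ J ∧ ∃ l : ℝ, 0 < l ∧
    (⨆ a : {a : ℝ // Set.Ioo a (a + l) ⊆ J}, (S ∩ Set.Ioo (a : ℝ) (a + l)).encard) <
      2 * ⨅ a : {a : ℝ // Set.Ioo a (a + l) ⊆ J}, (S ∩ Set.Ioo (a : ℝ) (a + l)).encard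

end Besicovitch

/-! Let `A` and `B` be the coefficient functions of `f₁` and `f`. On every finite set of exponents,
equivalence gives `B x = A x * e^{iψ(x)}` with `ψ` additive (`BohrEquiv.exists_coefficients`); in
particular |A| = |B| everywhere.

Existence of `g` is a Riesz–Fischer argument. Fourier partial sums of `f` converge to it in B²,
being best approximations. The B² norm of a trigonometric polynomial sees only the moduli of its
coefficients, so the partial sums formed with `A` are Cauchy as well, and completeness of B² gives
`g` with coefficients `A` (`exists_memB_two_of_norm_coeff_eq`). Then `f₁ - g` is an element of B¹
with no Fourier coefficients, hence null (`MemB.seminorm_one_eq_zero`).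

For the translates, a shift by τ turns `B x` into `B x * e^{ixτ}`, and this is close to `A x` once
`e^{i(ψ(x) + xτ)}` is close to 1. Additivity of `ψ` is exactly what Kronecker's theorem needs to
solve this on a finite set of exponents, and the solutions τ are relatively dense
(`exists_relatively_dense_norm_wave_sub_one_lt`). The tails beyond that finite set are small
uniformly in τ, because the seminorm does not grow under translation. A relatively dense set
contains both a sequence tending to infinity and a satisfactorily uniform set. -/

namespace Besicovitch

/-! ### Averages over symmetric windows and the Besicovitch seminorm -/

/-- The normalized Lebesgue measure on `(-l, l]`. -/
noncomputable def avgMeasure (l : ℝ) : Measure ℝ :=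
  (ENNReal.ofReal (2 * l))⁻¹ • volume.restrict (Set.Ioc (-l) l)

lemma isProbabilityMeasure_avgMeasure {l : ℝ} (hl : 0 < l) :
    IsProbabilityMeasure (avgMeasure l) := by
  constructor
  have h : l - -l = 2 * l := by ring
  simp only [avgMeasure, Measure.smul_apply, Measure.restrict_apply_univ, Real.volume_Ioc,
    smul_eq_mul, h]
  exact ENNReal.inv_mul_cancel (by simpa using hl) ENNReal.ofReal_ne_top

lemma avgMeasure_absolutelyContinuous (l : ℝ) : avgMeasure l ≪ volume :=
  (Measure.smul_absolutelyContinuous).trans Measure.restrict_le_self.absolutelyContinuous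

lemma integral_avgMeasure {E : Type*} [NormedAddCommGroup E] [NormedSpace ℝ E] (g : ℝ → E)
    {l : ℝ} (hl : 0 < l) : ∫ t, g t ∂avgMeasure l = (2 * l)⁻¹ • ∫ t in (-l)..l, g t := by
  rw [avgMeasure, integral_smul_measure, intervalIntegral.integral_of_le (by linarith),
    ENNReal.toReal_inv, ENNReal.toReal_ofReal (by linarith)]

lemma integrable_avgMeasure_iff {E : Type*} [NormedAddCommGroup E] {g : ℝ → E}
    {l : ℝ} (hl : 0 < l) : Integrable g (avgMeasure l) ↔ IntegrableOn g (Set.Ioc (-l) l) := by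
  rw [avgMeasure, integrable_smul_measure (by simp [ENNReal.mul_eq_top]) (by simpa using hl)]
  rfl

lemma tendsto_integral_avgMeasure_iff {E : Type*} [NormedAddCommGroup E] [NormedSpace ℝ E]
    (g : ℝ → E) (m : E) :
    Tendsto (fun l => ∫ t, g t ∂avgMeasure l) atTop (𝓝 m) ↔
      Tendsto (fun l : ℝ => (2 * l)⁻¹ • ∫ t in (-l)..l, g t) atTop (𝓝 m) := by
  refine tendsto_congr' ?_
  filter_upwards [eventually_gt_atTop 0] with l hl using integral_avgMeasure g hl

lemma seminorm_eq_limsup_eLpNorm {p : ℝ} (hp : 0 < p) (f : ℝ → ℂ) :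
    seminorm p f = limsup (fun l => eLpNorm f (ENNReal.ofReal p) (avgMeasure l)) atTop := by
  have h := (ENNReal.orderIsoRpow (1 / p) (by positivity)).limsup_apply (f := (atTop : Filter ℝ))
    (u := fun l : ℝ => (ENNReal.ofReal (2 * l))⁻¹ * ∫⁻ t in Set.Ioc (-l) l, ‖f t‖ₑ ^ p)
  simp only [ENNReal.orderIsoRpow_apply] at h
  rw [seminorm, h]
  congr 1
  ext l
  rw [eLpNorm_eq_lintegral_rpow_enorm_toReal (by simpa using hp) ENNReal.ofReal_ne_top,
    ENNReal.toReal_ofReal hp.le, avgMeasure, lintegral_smul_measure, smul_eq_mul]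

lemma seminorm_one_eq (f : ℝ → ℂ) :
    seminorm 1 f = limsup (fun l => eLpNorm f 1 (avgMeasure l)) atTop := by
  simpa using seminorm_eq_limsup_eLpNorm one_pos f

lemma seminorm_two_eq (f : ℝ → ℂ) :
    seminorm 2 f = limsup (fun l => eLpNorm f 2 (avgMeasure l)) atTop := by
  simpa using seminorm_eq_limsup_eLpNorm two_pos f

lemma seminorm_congr_norm (p : ℝ) {f g : ℝ → ℂ} (h : ∀ t, ‖f t‖ = ‖g t‖) :
    seminorm p f = seminorm p g := by
  have h' : ∀ t, ‖f t‖ₑ = ‖g t‖ₑ := fun t => by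
    rw [← ofReal_norm, ← ofReal_norm, h]
  simp only [seminorm, h']

lemma seminorm_sub_comm (p : ℝ) (f g : ℝ → ℂ) :
    seminorm p (fun t => f t - g t) = seminorm p (fun t => g t - f t) :=
  seminorm_congr_norm p fun _ => norm_sub_rev _ _

lemma limsup_add_le_ennreal {α : Type*} (F : Filter α) (u v : α → ℝ≥0∞) :
    limsup (fun x => u x + v x) F ≤ limsup u F + limsup v F := by
  refine ENNReal.le_of_forall_pos_le_add fun ε hε h => ?_
  obtain ⟨hu, hv⟩ := ENNReal.add_lt_top.1 h
  have hε' : ((ε / 2 : NNReal) : ℝ≥0∞) ≠ 0 := by simpa using hε.ne'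
  have h1 := eventually_lt_of_limsup_lt (ENNReal.lt_add_right hu.ne hε')
  have h2 := eventually_lt_of_limsup_lt (ENNReal.lt_add_right hv.ne hε')
  refine limsup_le_of_le (by isBoundedDefault) ?_
  filter_upwards [h1, h2] with x hx hy
  refine (add_le_add hx.le hy.le).trans (le_of_eq ?_)
  rw [add_add_add_comm, ← ENNReal.coe_add, add_halves]

lemma seminorm_add_le {p : ℝ} (hp : 1 ≤ p) {f g : ℝ → ℂ} (hf : AEStronglyMeasurable f volume)
    (hg : AEStronglyMeasurable g volume) :
    seminorm p (fun t => f t + g t) ≤ seminorm p f + seminorm p g := by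
  have hp0 : 0 < p := by linarith
  rw [seminorm_eq_limsup_eLpNorm hp0, seminorm_eq_limsup_eLpNorm hp0,
    seminorm_eq_limsup_eLpNorm hp0]
  refine le_trans (limsup_le_limsup (Eventually.of_forall fun l => ?_))
    (limsup_add_le_ennreal _ _ _)
  exact eLpNorm_add_le (hf.mono_ac (avgMeasure_absolutelyContinuous l))
    (hg.mono_ac (avgMeasure_absolutelyContinuous l)) (by simpa using hp)

lemma seminorm_sub_le {p : ℝ} (hp : 1 ≤ p) {f g k : ℝ → ℂ} (hf : AEStronglyMeasurable f volume)
    (hg : AEStronglyMeasurable g volume) (hk : AEStronglyMeasurable k volume) :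
    seminorm p (fun t => f t - k t) ≤
      seminorm p (fun t => f t - g t) + seminorm p (fun t => g t - k t) := by
  refine le_trans (le_of_eq ?_) (seminorm_add_le hp (hf.sub hg) (hg.sub hk))
  congr 1
  ext t
  simp

lemma seminorm_one_le_two {f : ℝ → ℂ} (hf : AEStronglyMeasurable f volume) :
    seminorm 1 f ≤ seminorm 2 f := by
  rw [seminorm_one_eq, seminorm_two_eq]
  refine limsup_le_limsup ?_
  filter_upwards [eventually_gt_atTop 0] with l hl
  have := isProbabilityMeasure_avgMeasure hl
  exact eLpNorm_le_eLpNorm_of_exponent_le (by norm_num)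
    (hf.mono_ac (avgMeasure_absolutelyContinuous l))

lemma seminorm_le_of_bound {p : ℝ} (hp : 0 < p) {f : ℝ → ℂ} {C : ℝ} (h : ∀ t, ‖f t‖ ≤ C) :
    seminorm p f ≤ ENNReal.ofReal C := by
  rw [seminorm_eq_limsup_eLpNorm hp]
  refine limsup_le_of_le (by isBoundedDefault) ?_
  filter_upwards [eventually_gt_atTop 0] with l hl
  have := isProbabilityMeasure_avgMeasure hl
  simpa using eLpNorm_le_of_ae_bound (p := ENNReal.ofReal p) (μ := avgMeasure l)
    (Eventually.of_forall h)

lemma eventually_eLpNorm_one_lt {f : ℝ → ℂ} {ε : ℝ≥0∞} (h : seminorm 1 f < ε) :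
    ∀ᶠ l in atTop, eLpNorm f 1 (avgMeasure l) < ε := by
  rw [seminorm_one_eq] at h
  exact eventually_lt_of_limsup_lt h

lemma eventually_eLpNorm_two_lt {f : ℝ → ℂ} {ε : ℝ≥0∞} (h : seminorm 2 f < ε) :
    ∀ᶠ l in atTop, eLpNorm f 2 (avgMeasure l) < ε := by
  rw [seminorm_two_eq] at h
  exact eventually_lt_of_limsup_lt h

lemma eventually_integrable_of_seminorm_lt_top {f : ℝ → ℂ} (hf : AEStronglyMeasurable f volume)
    (h : seminorm 1 f < ∞) : ∀ᶠ l in atTop, Integrable f (avgMeasure l) := by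
  filter_upwards [eventually_eLpNorm_one_lt h] with l hl
  exact memLp_one_iff_integrable.1 ⟨hf.mono_ac (avgMeasure_absolutelyContinuous l), hl⟩

lemma eventually_memLp_of_seminorm_lt_top {f : ℝ → ℂ} (hf : AEStronglyMeasurable f volume)
    (h : seminorm 2 f < ∞) : ∀ᶠ l in atTop, MemLp f 2 (avgMeasure l) := by
  filter_upwards [eventually_eLpNorm_two_lt h] with l hl
  exact ⟨hf.mono_ac (avgMeasure_absolutelyContinuous l), hl⟩

lemma locallyIntegrable_of_eventually_integrable {E : Type*} [NormedAddCommGroup E] {g : ℝ → E}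
    (h : ∀ᶠ l in atTop, Integrable g (avgMeasure l)) : LocallyIntegrable g volume := by
  rw [locallyIntegrable_iff]
  intro K hK
  obtain ⟨R, hR⟩ := hK.isBounded.exists_norm_le
  obtain ⟨l, hl, hl0, hlR⟩ := (h.and ((eventually_gt_atTop 0).and (eventually_gt_atTop R))).exists
  refine ((integrable_avgMeasure_iff hl0).1 hl).mono_set fun t ht => ?_
  have := abs_le.1 ((Real.norm_eq_abs t) ▸ hR t ht)
  exact ⟨by linarith, by linarith⟩

lemma toReal_eLpNorm_two_sq {μ : Measure ℝ} {g : ℝ → ℂ} (hg : MemLp g 2 μ) :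
    (eLpNorm g 2 μ).toReal ^ 2 = ∫ t, ‖g t‖ ^ 2 ∂μ := by
  have h := hg.eLpNorm_eq_integral_rpow_norm (by norm_num) (by norm_num)
  have h0 : 0 ≤ ∫ t, ‖g t‖ ^ 2 ∂μ := integral_nonneg fun t => by positivity
  simp only [ENNReal.toReal_ofNat, Real.rpow_ofNat] at h
  rw [h, ENNReal.toReal_ofReal (by positivity), ← Real.rpow_natCast, ← Real.rpow_mul h0]
  norm_num

/-- The window of half-length l shifted by τ lies inside the one of half-length l + |τ|, and the
ratio of their lengths tends to 1. -/
lemma limsup_average_translate_le (F : ℝ → ℝ≥0∞) (τ : ℝ) :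
    limsup (fun l : ℝ => (ENNReal.ofReal (2 * l))⁻¹ * ∫⁻ t in Set.Ioc (-l) l, F (t + τ)) atTop ≤
      limsup (fun l : ℝ => (ENNReal.ofReal (2 * l))⁻¹ * ∫⁻ t in Set.Ioc (-l) l, F t) atTop := by
  set u : ℝ → ℝ≥0∞ := fun l => (ENNReal.ofReal (2 * l))⁻¹ * ∫⁻ t in Set.Ioc (-l) l, F t with hu
  have key : ∀ l : ℝ, 0 < l →
      (ENNReal.ofReal (2 * l))⁻¹ * ∫⁻ t in Set.Ioc (-l) l, F (t + τ) ≤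
        ENNReal.ofReal (1 + |τ| / l) * u (l + |τ|) := by
    intro l hl
    have h1 : ∫⁻ t in Set.Ioc (-l) l, F (t + τ) ≤
        ∫⁻ t in Set.Ioc (-(l + |τ|)) (l + |τ|), F t := by
      rw [← lintegral_indicator measurableSet_Ioc, ← lintegral_indicator measurableSet_Ioc,
        
        ← lintegral_add_right_eq_self (Set.indicator (Set.Ioc (-(l + |τ|)) (l + |τ|)) F) τ]
      refine lintegral_mono fun t => ?_
      by_cases ht : t ∈ Set.Ioc (-l) l
      · have ht' : t + τ ∈ Set.Ioc (-(l + |τ|)) (l + |τ|) :=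
          ⟨by linarith [ht.1, neg_abs_le τ], by linarith [ht.2, le_abs_self τ]⟩
        rw [Set.indicator_of_mem ht, Set.indicator_of_mem ht']
      · rw [Set.indicator_of_notMem ht]
        exact zero_le
    have hpos : 0 < l + |τ| := by positivity
    have h2 : ENNReal.ofReal (1 + |τ| / l) * (ENNReal.ofReal (2 * (l + |τ|)))⁻¹ =
        (ENNReal.ofReal (2 * l))⁻¹ := by
      rw [← ENNReal.ofReal_inv_of_pos (by positivity), ← ENNReal.ofReal_inv_of_pos (by positivity),
        ← ENNReal.ofReal_mul (by positivity)]
      congr 1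
      field_simp
    rw [hu]
    simp only
    rw [← mul_assoc, h2]
    gcongr
  have hlim : Tendsto (fun l : ℝ => ENNReal.ofReal (1 + |τ| / l)) atTop (𝓝 1) := by
    have : Tendsto (fun l : ℝ => 1 + |τ| / l) atTop (𝓝 (1 + 0)) :=
      tendsto_const_nhds.add (tendsto_const_nhds.div_atTop tendsto_id)
    simpa using ENNReal.tendsto_ofReal this
  calc _ ≤ limsup (fun l : ℝ => ENNReal.ofReal (1 + |τ| / l) * u (l + |τ|)) atTop := by
        refine limsup_le_limsup ?_
        filter_upwards [eventually_gt_atTop 0] with l hl using key l hl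
    _ ≤ limsup (fun l : ℝ => ENNReal.ofReal (1 + |τ| / l)) atTop *
          limsup (fun l => u (l + |τ|)) atTop := by
        refine ENNReal.limsup_mul_le' ?_ ?_ <;> simp [hlim.limsup_eq]
    _ = limsup (u ∘ fun l => l + |τ|) atTop := by rw [hlim.limsup_eq, one_mul]; rfl
    _ ≤ limsup u atTop := by
        rw [limsup_comp]
        exact limsup_le_limsup_of_le (tendsto_atTop_add_const_right _ _ tendsto_id)

lemma seminorm_translate_le {p : ℝ} (hp : 0 < p) (f : ℝ → ℂ) (τ : ℝ) :
    seminorm p (fun t => f (t + τ)) ≤ seminorm p f :=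
  ENNReal.rpow_le_rpow (limsup_average_translate_le (fun t => ‖f t‖ₑ ^ p) τ) (by positivity)

/-! ### Waves and trigonometric polynomials -/

/-- The pure oscillation `t ↦ e^{ixt}`. -/
noncomputable def wave (x : ℝ) : ℝ → ℂ := fun t => Complex.exp (Complex.I * (x : ℂ) * (t : ℂ))

lemma wave_eq_exp_ofReal_mul_I (x t : ℝ) :
    wave x t = Complex.exp (((x * t : ℝ) : ℂ) * Complex.I) := by
  rw [wave]; push_cast; ring_nf

lemma norm_wave (x t : ℝ) : ‖wave x t‖ = 1 := by
  rw [wave_eq_exp_ofReal_mul_I, Complex.norm_exp_ofReal_mul_I]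

lemma continuous_wave (x : ℝ) : Continuous (wave x) := by unfold wave; fun_prop

lemma wave_zero : wave 0 = 1 := by ext t; simp [wave]

lemma wave_zero_right (x : ℝ) : wave x 0 = 1 := by simp [wave]

lemma wave_add_left (x y t : ℝ) : wave (x + y) t = wave x t * wave y t := by
  simp only [wave, ← Complex.exp_add]; push_cast; ring_nf

lemma wave_mul (x y : ℝ) : wave x * wave y = wave (x + y) := by
  ext t; simp [wave_add_left]

lemma wave_add_right (x t τ : ℝ) : wave x (t + τ) = wave x t * wave x τ := by
  simp only [wave, ← Complex.exp_add]; push_cast; ring_nf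

lemma wave_neg (x t : ℝ) : wave (-x) t = Complex.exp (-(Complex.I * (x : ℂ) * (t : ℂ))) := by
  simp [wave]

lemma star_wave (x t : ℝ) : star (wave x t) = wave (-x) t := by
  rw [wave, wave, Complex.star_def, ← Complex.exp_conj]
  simp

/-- The trigonometric polynomial with coefficients `c` on the finite set `s` of exponents. -/
noncomputable def trigSum (s : Finset ℝ) (c : ℝ → ℂ) : ℝ → ℂ := fun t => ∑ x ∈ s, c x * wave x t

lemma isTrigPoly_trigSum (s : Finset ℝ) (c : ℝ → ℂ) : IsTrigPoly (trigSum s c) := ⟨s, c, rfl⟩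

lemma isTrigPoly_iff_mem_span {P : ℝ → ℂ} :
    IsTrigPoly P ↔ P ∈ Submodule.span ℂ (Set.range wave) := by
  constructor
  · rintro ⟨s, c, rfl⟩
    have : (fun t : ℝ => ∑ x ∈ s, c x * Complex.exp (Complex.I * (x : ℂ) * (t : ℂ))) =
        ∑ x ∈ s, c x • wave x := by
      ext t; simp [wave]
    rw [this]
    exact Submodule.sum_mem _ fun x _ =>
      Submodule.smul_mem _ _ (Submodule.subset_span (Set.mem_range_self x))
  · intro h
    obtain ⟨c, hc⟩ := Finsupp.mem_span_range_iff_exists_finsupp.1 h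
    refine ⟨c.support, c, ?_⟩
    rw [← hc]
    ext t
    simp [Finsupp.sum, wave]

namespace IsTrigPoly

variable {P Q : ℝ → ℂ}

lemma sub (hP : IsTrigPoly P) (hQ : IsTrigPoly Q) : IsTrigPoly (P - Q) :=
  isTrigPoly_iff_mem_span.2 (Submodule.sub_mem _ (isTrigPoly_iff_mem_span.1 hP)
    (isTrigPoly_iff_mem_span.1 hQ))

lemma mul (hP : IsTrigPoly P) (hQ : IsTrigPoly Q) : IsTrigPoly (P * Q) := by
  rw [isTrigPoly_iff_mem_span] at *
  have h := Submodule.mul_mem_mul hP hQ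
  rw [Submodule.span_mul_span] at h
  refine Submodule.span_mono ?_ h
  rintro _ ⟨_, ⟨x, rfl⟩, _, ⟨y, rfl⟩, rfl⟩
  exact ⟨x + y, (wave_mul x y).symm⟩

lemma const (c : ℂ) : IsTrigPoly fun _ => c :=
  ⟨{0}, fun _ => c, by ext t; simp⟩

lemma sum {ι : Type*} (s : Finset ι) {F : ι → ℝ → ℂ} (h : ∀ i ∈ s, IsTrigPoly (F i)) :
    IsTrigPoly (∑ i ∈ s, F i) :=
  isTrigPoly_iff_mem_span.2 (Submodule.sum_mem _ fun i hi => isTrigPoly_iff_mem_span.1 (h i hi))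

lemma pow (hP : IsTrigPoly P) (n : ℕ) : IsTrigPoly (P ^ n) := by
  induction n with
  | zero => rw [pow_zero]; exact const 1
  | succ n ih => rw [pow_succ]; exact ih.mul hP

lemma star (hP : IsTrigPoly P) : IsTrigPoly (star P) := by
  obtain ⟨s, c, rfl⟩ := hP
  have h : (Star.star fun t : ℝ => ∑ x ∈ s, c x * Complex.exp (Complex.I * (x : ℂ) * (t : ℂ))) =
      ∑ x ∈ s, Star.star (c x) • wave (-x) := by
    ext t
    simp only [Pi.star_apply, star_sum, star_mul', Finset.sum_apply, Pi.smul_apply, smul_eq_mul]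
    refine Finset.sum_congr rfl fun x _ => ?_
    rw [← star_wave x t]; rfl
  rw [h, isTrigPoly_iff_mem_span]
  exact Submodule.sum_mem _ fun x _ =>
      Submodule.smul_mem _ _ (Submodule.subset_span (Set.mem_range_self (-x)))

lemma polynomial_eval (hP : IsTrigPoly P) (q : Polynomial ℂ) :
    IsTrigPoly fun t => q.eval (P t) := by
  have : (fun t => q.eval (P t)) =
      ∑ i ∈ Finset.range (q.natDegree + 1), (fun _ => q.coeff i) * P ^ i := by
    ext t
    simp [Polynomial.eval_eq_sum_range]
  rw [this]
  exact sum _ fun i _ => (const _).mul (hP.pow i)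

lemma translate (hP : IsTrigPoly P) (τ : ℝ) : IsTrigPoly fun t => P (t + τ) := by
  obtain ⟨s, c, rfl⟩ := hP
  refine ⟨s, fun x => c x * wave x τ, ?_⟩
  ext t
  refine Finset.sum_congr rfl fun x _ => ?_
  have := wave_add_right x t τ
  simp only [wave] at this ⊢
  rw [this]
  ring

lemma continuous (hP : IsTrigPoly P) : Continuous P := by
  obtain ⟨s, c, rfl⟩ := hP
  fun_prop

lemma exists_bound (hP : IsTrigPoly P) : ∃ C : ℝ, 0 < C ∧ ∀ t, ‖P t‖ ≤ C := by
  obtain ⟨s, c, rfl⟩ := hP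
  refine ⟨∑ x ∈ s, ‖c x‖ + 1, by positivity, fun t => ?_⟩
  refine (norm_sum_le _ _).trans ((Finset.sum_le_sum fun x _ => ?_).trans
    (le_add_of_nonneg_right zero_le_one))
  have := norm_wave x t
  rw [wave] at this
  rw [norm_mul, this, mul_one]

lemma aestronglyMeasurable (hP : IsTrigPoly P) : AEStronglyMeasurable P volume :=
  hP.continuous.aestronglyMeasurable

lemma seminorm_lt_top (hP : IsTrigPoly P) {p : ℝ} (hp : 0 < p) : seminorm p P < ∞ := by
  obtain ⟨C, -, hC⟩ := hP.exists_bound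
  exact (seminorm_le_of_bound hp hC).trans_lt ENNReal.ofReal_lt_top

end IsTrigPoly

/-! ### Mean values and orthogonality of waves -/

lemma integrable_avgMeasure_of_continuous {E : Type*} [NormedAddCommGroup E] {g : ℝ → E}
    (hg : Continuous g) (l : ℝ) : Integrable g (avgMeasure l) := by
  rcases le_or_gt l 0 with hl | hl
  · have : avgMeasure l = 0 := by
      rw [avgMeasure, Set.Ioc_eq_empty (by linarith)]; simp
    rw [this]
    exact integrable_zero_measure
  · rw [integrable_avgMeasure_iff hl]
    exact (hg.integrableOn_Icc).mono_set Set.Ioc_subset_Icc_self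

lemma tendsto_integral_wave (x : ℝ) :
    Tendsto (fun l => ∫ t, wave x t ∂avgMeasure l) atTop (𝓝 (if x = 0 then 1 else 0)) := by
  split_ifs with hx
  · refine tendsto_const_nhds.congr' ?_
    filter_upwards [eventually_gt_atTop 0] with l hl
    have := isProbabilityMeasure_avgMeasure hl
    simp [hx, wave_zero]
  · rw [tendsto_integral_avgMeasure_iff]
    have hx' : Complex.I * (x : ℂ) ≠ 0 := by simpa using hx
    refine squeeze_zero_norm' (a := fun l : ℝ => (2 * l)⁻¹ * (2 / |x|)) ?_ ?_
    · filter_upwards [eventually_gt_atTop 0] with l hl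
      rw [norm_smul, Real.norm_of_nonneg (by positivity)]
      gcongr
      simp only [wave]
      rw [integral_exp_mul_complex hx', norm_div]
      have h1 : ‖Complex.I * (x : ℂ)‖ = |x| := by simp
      rw [h1]
      gcongr
      refine (norm_sub_le _ _).trans (le_of_eq ?_)
      have h2 := norm_wave x l
      have h3 := norm_wave x (-l)
      simp only [wave] at h2 h3
      rw [h2, h3]; norm_num
    · have : Tendsto (fun l : ℝ => (2 * l)⁻¹) atTop (𝓝 0) :=
        tendsto_inv_atTop_zero.comp (tendsto_id.const_mul_atTop two_pos)
      simpa using this.mul_const (2 / |x|)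

lemma tendsto_integral_trigSum_mul_wave_neg (s : Finset ℝ) (c : ℝ → ℂ) (y : ℝ) :
    Tendsto (fun l => ∫ t, trigSum s c t * wave (-y) t ∂avgMeasure l) atTop
      (𝓝 (if y ∈ s then c y else 0)) := by
  have h : ∀ l, ∫ t, trigSum s c t * wave (-y) t ∂avgMeasure l =
      ∑ x ∈ s, c x * ∫ t, wave (x + -y) t ∂avgMeasure l := by
    intro l
    simp only [← integral_const_mul]
    rw [← integral_finsetSum _ fun x _ =>
      (integrable_avgMeasure_of_continuous (continuous_wave _) l).const_mul _]
    congr 1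
    ext t
    simp only [trigSum, Finset.sum_mul, wave_add_left, mul_assoc]
  simp only [h]
  have h2 : (if y ∈ s then c y else 0) = ∑ x ∈ s, c x * (if x + -y = 0 then 1 else 0) := by
    simp [add_neg_eq_zero]
  rw [h2]
  exact tendsto_finsetSum _ fun x _ => (tendsto_integral_wave _).const_mul _

/-- Pairing with a trigonometric polynomial is determined by the coefficients of `h`. This serves
three times: for Parseval, for best approximation, and for the uniqueness theorem. -/
lemma tendsto_integral_mul_trigSum_star {h : ℝ → ℂ}
    (hi : ∀ᶠ l in atTop, Integrable h (avgMeasure l)) {A : ℝ → ℂ}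
    (hA : ∀ x, Tendsto (fun l => ∫ t, h t * wave (-x) t ∂avgMeasure l) atTop (𝓝 (A x)))
    (s : Finset ℝ) (c : ℝ → ℂ) :
    Tendsto (fun l => ∫ t, h t * star (trigSum s c t) ∂avgMeasure l) atTop
      (𝓝 (∑ x ∈ s, star (c x) * A x)) := by
  refine (tendsto_finsetSum s fun x _ => (hA x).const_mul (star (c x))).congr' ?_
  filter_upwards [hi] with l hl
  simp only [← integral_const_mul]
  rw [← integral_finsetSum _ fun x _ => Integrable.const_mul
    (hl.mul_bdd (c := 1) (continuous_wave _).aestronglyMeasurable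
      (Eventually.of_forall fun t => (norm_wave _ t).le)) _]
  congr 1
  ext t
  simp only [trigSum, star_sum, star_mul', star_wave, Finset.mul_sum]
  exact Finset.sum_congr rfl fun x _ => by ring

lemma tendsto_integral_norm_sq_trigSum (s : Finset ℝ) (c : ℝ → ℂ) :
    Tendsto (fun l => ∫ t, ‖trigSum s c t‖ ^ 2 ∂avgMeasure l) atTop
      (𝓝 (∑ x ∈ s, ‖c x‖ ^ 2)) := by
  have h := tendsto_integral_mul_trigSum_star
    (Eventually.of_forall fun l => integrable_avgMeasure_of_continuous
      (isTrigPoly_trigSum s c).continuous l)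
    (fun x => tendsto_integral_trigSum_mul_wave_neg s c x) s c
  have key : ∀ z : ℂ, z * star z = ((‖z‖ ^ 2 : ℝ) : ℂ) := fun z => by
    rw [Complex.star_def, Complex.mul_conj']; push_cast; rfl
  have h2 : ∑ x ∈ s, star (c x) * (if x ∈ s then c x else 0) =
      ((∑ x ∈ s, ‖c x‖ ^ 2 : ℝ) : ℂ) := by
    rw [Complex.ofReal_sum]
    refine Finset.sum_congr rfl fun x hx => ?_
    rw [if_pos hx, mul_comm, key]
  simp only [key, h2, integral_complex_ofReal] at h
  have := (Complex.continuous_re.tendsto _).comp h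
  simpa only [Function.comp_def, Complex.ofReal_re] using this

lemma memLp_two_avgMeasure_of_continuous {g : ℝ → ℂ} (hg : Continuous g) (l : ℝ) :
    MemLp g 2 (avgMeasure l) := by
  rw [memLp_two_iff_integrable_sq_norm hg.aestronglyMeasurable]
  exact integrable_avgMeasure_of_continuous (by fun_prop) l

lemma tendsto_eLpNorm_trigSum (s : Finset ℝ) (c : ℝ → ℂ) :
    Tendsto (fun l => (eLpNorm (trigSum s c) 2 (avgMeasure l)).toReal) atTop
      (𝓝 (√(∑ x ∈ s, ‖c x‖ ^ 2))) := by
  refine ((Real.continuous_sqrt.tendsto _).comp (tendsto_integral_norm_sq_trigSum s c)).congr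
    fun l => ?_
  rw [Function.comp, ← toReal_eLpNorm_two_sq
    (memLp_two_avgMeasure_of_continuous (isTrigPoly_trigSum s c).continuous l),
    Real.sqrt_sq ENNReal.toReal_nonneg]

/-- Only the moduli of the coefficients enter, so changing their phases preserves Cauchy estimates.
-/
lemma seminorm_two_trigSum (s : Finset ℝ) (c : ℝ → ℂ) :
    seminorm 2 (trigSum s c) = ENNReal.ofReal (√(∑ x ∈ s, ‖c x‖ ^ 2)) := by
  rw [seminorm_two_eq]
  refine (Tendsto.congr (fun l => ?_)
    (ENNReal.tendsto_ofReal (tendsto_eLpNorm_trigSum s c))).limsup_eq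
  exact ENNReal.ofReal_toReal (memLp_two_avgMeasure_of_continuous
    (isTrigPoly_trigSum s c).continuous l).2.ne

lemma trigSum_sub_trigSum_of_subset {s s' : Finset ℝ} (h : s ⊆ s') (c : ℝ → ℂ) (t : ℝ) :
    trigSum s' c t - trigSum s c t = trigSum (s' \ s) c t := by
  rw [trigSum, trigSum, trigSum, ← Finset.sum_sdiff h]
  ring

lemma trigSum_sub (s : Finset ℝ) (c d : ℝ → ℂ) (t : ℝ) :
    trigSum s c t - trigSum s d t = trigSum s (fun x => c x - d x) t := by
  simp only [trigSum, ← Finset.sum_sub_distrib, sub_mul]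

lemma trigSum_translate (s : Finset ℝ) (c : ℝ → ℂ) (t τ : ℝ) :
    trigSum s c (t + τ) = trigSum s (fun x => c x * wave x τ) t := by
  simp only [trigSum, wave_add_right]
  exact Finset.sum_congr rfl fun x _ => by ring

/-! ### The spaces B¹ and B²: quadratic means and best approximation -/

namespace MemB

variable {p : ℝ} {f g : ℝ → ℂ}

lemma sub (hp : 1 ≤ p) (hf : MemB p f) (hg : MemB p g) : MemB p fun t => f t - g t := by
  refine ⟨hf.1.sub hg.1, fun ε hε => ?_⟩
  obtain ⟨P, hP, hfP⟩ := hf.2 (ε / 2) (ENNReal.half_pos hε.ne')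
  obtain ⟨Q, hQ, hgQ⟩ := hg.2 (ε / 2) (ENNReal.half_pos hε.ne')
  refine ⟨P - Q, hP.sub hQ, ?_⟩
  rw [seminorm_sub_comm] at hgQ
  have h := seminorm_add_le hp (hf.1.sub hP.aestronglyMeasurable)
    (hQ.aestronglyMeasurable.sub hg.1)
  refine lt_of_eq_of_lt ?_ (h.trans_lt ((ENNReal.add_lt_add hfP hgQ).trans_eq
    (ENNReal.add_halves ε)))
  congr 1
  ext t
  simp only [Pi.sub_apply]
  ring

lemma translate (hp : 0 < p) (hf : MemB p f) (τ : ℝ) : MemB p fun t => f (t + τ) := by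
  refine ⟨hf.1.comp_quasiMeasurePreserving
    (measurePreserving_add_right volume τ).quasiMeasurePreserving, fun ε hε => ?_⟩
  obtain ⟨P, hP, hfP⟩ := hf.2 ε hε
  exact ⟨_, hP.translate τ, (seminorm_translate_le hp (fun t => f t - P t) τ).trans_lt hfP⟩

lemma one_of_two (hf : MemB 2 f) : MemB 1 f := by
  refine ⟨hf.1, fun ε hε => ?_⟩
  obtain ⟨P, hP, hfP⟩ := hf.2 ε hε
  exact ⟨P, hP, (seminorm_one_le_two (hf.1.sub hP.aestronglyMeasurable)).trans_lt hfP⟩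

lemma seminorm_lt_top (hp : 1 ≤ p) (hf : MemB p f) : seminorm p f < ∞ := by
  obtain ⟨P, hP, hfP⟩ := hf.2 1 one_pos
  have h := seminorm_add_le hp (hf.1.sub hP.aestronglyMeasurable) hP.aestronglyMeasurable
  simp only [Pi.sub_apply, sub_add_cancel] at h
  exact h.trans_lt (ENNReal.add_lt_top.2
    ⟨hfP.trans ENNReal.one_lt_top, hP.seminorm_lt_top (by linarith)⟩)

lemma eventually_integrable (hf : MemB 1 f) : ∀ᶠ l in atTop, Integrable f (avgMeasure l) :=
  eventually_integrable_of_seminorm_lt_top hf.1 (hf.seminorm_lt_top le_rfl)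

lemma eventually_memLp (hf : MemB 2 f) : ∀ᶠ l in atTop, MemLp f 2 (avgMeasure l) :=
  eventually_memLp_of_seminorm_lt_top hf.1 (hf.seminorm_lt_top one_le_two)

end MemB

lemma IsTrigPoly.memB {P : ℝ → ℂ} (hP : IsTrigPoly P) {p : ℝ} (hp : 0 < p) : MemB p P := by
  refine ⟨hP.aestronglyMeasurable, fun ε hε => ⟨P, hP, ?_⟩⟩
  have := seminorm_le_of_bound (f := fun t => P t - P t) (C := 0) hp (by simp)
  exact this.trans_lt (by simpa using hε)

lemma norm_integral_mul_le {μ : Measure ℝ} {r φ : ℝ → ℂ} {C : ℝ} (hr : Integrable r μ)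
    (hφ : ∀ t, ‖φ t‖ ≤ C) : ‖∫ t, r t * φ t ∂μ‖ ≤ C * (eLpNorm r 1 μ).toReal := by
  rw [eLpNorm_one_eq_lintegral_enorm, ← integral_norm_eq_lintegral_enorm hr.1,
    ← integral_const_mul]
  refine norm_integral_le_of_norm_le (hr.norm.const_mul C) (Eventually.of_forall fun t => ?_)
  rw [norm_mul, mul_comm]
  gcongr
  exact hφ t

/-- Mean values against a pure oscillation are continuous for the seminorm of `B¹`. -/

lemma tendsto_integral_mul_wave_of_approx {h : ℝ → ℂ}
    (hh : ∀ᶠ l in atTop, Integrable h (avgMeasure l)) {x : ℝ} {m : ℂ}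
    (H : ∀ ε : ℝ, 0 < ε → ∃ (k : ℝ → ℂ) (m' : ℂ),
      (∀ᶠ l in atTop, Integrable k (avgMeasure l)) ∧
      seminorm 1 (fun t => h t - k t) < ENNReal.ofReal ε ∧
      Tendsto (fun l => ∫ t, k t * wave x t ∂avgMeasure l) atTop (𝓝 m') ∧ ‖m' - m‖ < ε) :
    Tendsto (fun l => ∫ t, h t * wave x t ∂avgMeasure l) atTop (𝓝 m) := by
  rw [Metric.tendsto_nhds]
  intro ε hε
  obtain ⟨k, m', hk, hhk, hkm, hm⟩ := H (ε / 3) (by positivity)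
  filter_upwards [hh, hk, eventually_eLpNorm_one_lt hhk,
    Metric.tendsto_nhds.1 hkm (ε / 3) (by positivity)] with l h1 h2 h3 h4
  have hb : ∀ {q : ℝ → ℂ}, Integrable q (avgMeasure l) →
      Integrable (fun t => q t * wave x t) (avgMeasure l) := fun hq =>
    hq.mul_bdd (c := 1) (continuous_wave _).aestronglyMeasurable
      (Eventually.of_forall fun t => (norm_wave _ t).le)
  have h5 : ‖∫ t, (h t - k t) * wave x t ∂avgMeasure l‖ < ε / 3 := by
    refine (norm_integral_mul_le (h1.sub h2) (C := 1) fun t => (norm_wave x t).le).trans_lt ?_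
    rw [one_mul]
    exact (ENNReal.lt_ofReal_iff_toReal_lt (h3.trans ENNReal.ofReal_lt_top).ne).1 h3
  simp only [sub_mul] at h5
  rw [integral_sub (hb h1) (hb h2), ← dist_eq_norm] at h5
  rw [← dist_eq_norm] at hm
  linarith [dist_triangle4 (∫ t, h t * wave x t ∂avgMeasure l) (∫ t, k t * wave x t ∂avgMeasure l)
    m' m]

lemma exists_tendsto_of_uniform_approx {x : ℝ → ℝ}
    (H : ∀ ε : ℝ, 0 < ε → ∃ (y : ℝ → ℝ) (m : ℝ), Tendsto y atTop (𝓝 m) ∧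
      ∀ᶠ l in atTop, |x l - y l| < ε) : ∃ m, Tendsto x atTop (𝓝 m) := by
  rw [← cauchy_map_iff_exists_tendsto, Metric.cauchy_iff]
  refine ⟨inferInstance, fun ε hε => ?_⟩
  obtain ⟨y, m, hy, hxy⟩ := H (ε / 4) (by positivity)
  refine ⟨Metric.ball m (ε / 2), ?_, fun a ha b hb => ?_⟩
  · rw [mem_map]
    filter_upwards [hxy, Metric.tendsto_nhds.1 hy (ε / 4) (by positivity)] with l h1 h2
    rw [← Real.dist_eq] at h1
    exact Metric.mem_ball.2 (by linarith [dist_triangle (x l) (y l) m])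
  · rw [Metric.mem_ball] at ha hb
    linarith [dist_triangle_right a b m]

/-- The quadratic mean of a function of `B²` exists. -/

lemma MemB.exists_tendsto_integral_norm_sq {h : ℝ → ℂ} (hh : MemB 2 h) :
    ∃ m : ℝ, 0 ≤ m ∧ seminorm 2 h = ENNReal.ofReal m ∧
      Tendsto (fun l => ∫ t, ‖h t‖ ^ 2 ∂avgMeasure l) atTop (𝓝 (m ^ 2)) := by
  obtain ⟨m, hm⟩ : ∃ m, Tendsto (fun l => (eLpNorm h 2 (avgMeasure l)).toReal) atTop (𝓝 m) := by
    refine exists_tendsto_of_uniform_approx fun ε hε => ?_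
    obtain ⟨P, ⟨s, c, rfl⟩, hP⟩ := hh.2 (ENNReal.ofReal ε) (by simpa using hε)
    refine ⟨_, _, tendsto_eLpNorm_trigSum s c, ?_⟩
    filter_upwards [hh.eventually_memLp, eventually_eLpNorm_two_lt hP] with l h1 h2
    have h3 := memLp_two_avgMeasure_of_continuous (isTrigPoly_trigSum s c).continuous l
    change eLpNorm (h - trigSum s c) 2 _ < _ at h2
    -- The norm itself, not its square, obeys the triangle inequality: on each window the norms of
    -- `h` and of the polynomial differ by less than ε.
    have h4 := eLpNorm_sub_le (p := 2) (h1.sub h3).1 h1.1 (by norm_num)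
    have h5 := eLpNorm_add_le (p := 2) (h1.sub h3).1 h3.1 (by norm_num)
    have h6 : (eLpNorm (h - trigSum s c) 2 (avgMeasure l)).toReal < ε :=
      (ENNReal.lt_ofReal_iff_toReal_lt (h1.sub h3).2.ne).1 h2
    rw [sub_add_cancel] at h5
    have e : h - trigSum s c - h = -trigSum s c := by abel
    rw [e, eLpNorm_neg] at h4
    have h4' := ENNReal.toReal_mono (ENNReal.add_lt_top.2 ⟨(h1.sub h3).2, h1.2⟩).ne h4
    have h5' := ENNReal.toReal_mono (ENNReal.add_lt_top.2 ⟨(h1.sub h3).2, h3.2⟩).ne h5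
    rw [ENNReal.toReal_add (h1.sub h3).2.ne h1.2.ne] at h4'
    rw [ENNReal.toReal_add (h1.sub h3).2.ne h3.2.ne] at h5'
    rw [abs_lt]
    constructor <;> linarith
  refine ⟨m, ge_of_tendsto' hm fun l => ENNReal.toReal_nonneg, ?_, ?_⟩
  · rw [seminorm_two_eq]
    refine (Tendsto.congr' ?_ (ENNReal.tendsto_ofReal hm)).limsup_eq
    filter_upwards [hh.eventually_memLp] with l hl using ENNReal.ofReal_toReal hl.2.ne
  · refine (hm.pow 2).congr' ?_
    filter_upwards [hh.eventually_memLp] with l hl using toReal_eLpNorm_two_sq hl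

lemma MemB.exists_hasMean_norm_sq {h : ℝ → ℂ} (hh : MemB 2 h) {ε : ℝ}
    (hlt : seminorm 2 h < ENNReal.ofReal (√ε)) :
    ∃ m, HasMean (fun t => ‖h t‖ ^ 2) m ∧ m < ε := by
  obtain ⟨m, hm0, hm, hlim⟩ := hh.exists_tendsto_integral_norm_sq
  refine ⟨m ^ 2, ⟨locallyIntegrable_of_eventually_integrable ?_,
    (tendsto_integral_avgMeasure_iff _ _).1 hlim⟩, ?_⟩
  · filter_upwards [hh.eventually_memLp] with l hl
    exact (memLp_two_iff_integrable_sq_norm hl.1).1 hl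
  · rw [hm, ENNReal.ofReal_lt_ofReal_iff_of_nonneg hm0] at hlt
    exact (Real.lt_sqrt hm0).1 hlt

/-- The partial sums of the Fourier series of a function of `B²` converge to it along the directed
set of finite sets of exponents. -/

lemma MemB.exists_seminorm_sub_trigSum_lt {f : ℝ → ℂ} (hf : MemB 2 f) {B : ℝ → ℂ}
    (hB : ∀ x, Tendsto (fun l => ∫ t, f t * wave (-x) t ∂avgMeasure l) atTop (𝓝 (B x)))
    {ε : ℝ≥0∞} (hε : 0 < ε) :
    ∃ s₀ : Finset ℝ, ∀ s, s₀ ⊆ s → seminorm 2 (fun t => f t - trigSum s B t) < ε := by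
  classical
  obtain ⟨P, ⟨s₀, c₀, rfl⟩, hP⟩ := hf.2 ε hε
  refine ⟨s₀, fun s hs => lt_of_le_of_lt ?_ hP⟩
  change _ ≤ seminorm 2 (fun t => f t - trigSum s₀ c₀ t)
  -- The approximating polynomial is rewritten over the larger set `s` with zero coefficients, so
  -- that it competes with the Fourier partial sum over `s`.
  set c : ℝ → ℂ := fun x => if x ∈ s₀ then c₀ x else 0
  have hc : trigSum s₀ c₀ = trigSum s c := by
    ext t
    rw [trigSum, trigSum, ← Finset.sum_subset hs fun x _ hx => by simp [c, hx]]
    exact Finset.sum_congr rfl fun x hx => by simp [c, hx]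
  rw [hc]
  set E : ℝ → ℂ := fun t => f t - trigSum s B t with hE
  set D : ℝ → ℂ := trigSum s (fun x => B x - c x) with hD
  have hED : ∀ t, f t - trigSum s c t = E t + D t := fun t => by
    simp only [hE, hD, ← trigSum_sub]; ring
  have hEB : MemB 2 E := hf.sub one_le_two ((isTrigPoly_trigSum s B).memB two_pos)
  have hFB : MemB 2 fun t => f t - trigSum s c t :=
    hf.sub one_le_two ((isTrigPoly_trigSum s c).memB two_pos)
  have hEcoeff : ∀ x, Tendsto (fun l => ∫ t, E t * wave (-x) t ∂avgMeasure l) atTop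
      (𝓝 (B x - if x ∈ s then B x else 0)) := by
    intro x
    refine ((hB x).sub (tendsto_integral_trigSum_mul_wave_neg s B x)).congr' ?_
    filter_upwards [hf.one_of_two.eventually_integrable] with l hl
    rw [← integral_sub]
    · simp only [hE, sub_mul]
    · exact hl.mul_bdd (c := 1) (continuous_wave _).aestronglyMeasurable
        (Eventually.of_forall fun t => (norm_wave _ t).le)
    · exact integrable_avgMeasure_of_continuous
        ((isTrigPoly_trigSum s B).continuous.mul (continuous_wave _)) l
  -- The error `E` has vanishing coefficients on `s`, hence is orthogonal to `D`. By Pythagoras the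
  -- mean square of `E` is at most that of `E + D`.
  have hcross : Tendsto (fun l => ∫ t, E t * star (D t) ∂avgMeasure l) atTop (𝓝 0) := by
    have := tendsto_integral_mul_trigSum_star hEB.one_of_two.eventually_integrable hEcoeff s
      (fun x => B x - c x)
    rwa [Finset.sum_eq_zero fun x hx => by simp [hx]] at this
  obtain ⟨m, hm0, hm, hmlim⟩ := hEB.exists_tendsto_integral_norm_sq
  obtain ⟨n, hn0, hn, hnlim⟩ := hFB.exists_tendsto_integral_norm_sq
  have hre := (Complex.continuous_re.tendsto _).comp hcross
  have hle : m ^ 2 ≤ n ^ 2 := by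
    have hlim := hnlim.sub (hre.const_mul 2)
    simp only [Complex.zero_re, mul_zero, sub_zero] at hlim
    refine le_of_tendsto_of_tendsto hmlim hlim ?_
    filter_upwards [hEB.eventually_memLp, hFB.eventually_memLp] with l h1 h2
    have hDl : MemLp D 2 (avgMeasure l) :=
      memLp_two_avgMeasure_of_continuous (isTrigPoly_trigSum _ _).continuous l
    have hi : Integrable (fun t => E t * star (D t)) (avgMeasure l) := h1.integrable_mul hDl.star
    have h1' := (memLp_two_iff_integrable_sq_norm h1.1).1 h1
    have h2' := (memLp_two_iff_integrable_sq_norm h2.1).1 h2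
    have hre_int : (∫ t, E t * star (D t) ∂avgMeasure l).re =
        ∫ t, (E t * star (D t)).re ∂avgMeasure l := (integral_re hi).symm
    simp only [Function.comp_apply]
    have hire : Integrable (fun t => 2 * (E t * star (D t)).re) (avgMeasure l) :=
      hi.re.const_mul 2
    rw [hre_int, ← integral_const_mul, ← integral_sub h2' hire]
    refine integral_mono h1' (h2'.sub hire) fun t => ?_
    simp only [hED]
    have h3 : ‖E t + D t‖ ^ 2 = ‖E t‖ ^ 2 + ‖D t‖ ^ 2 + 2 * (E t * star (D t)).re := by
      rw [← Complex.normSq_eq_norm_sq, Complex.normSq_add, Complex.normSq_eq_norm_sq,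
        Complex.normSq_eq_norm_sq]
      rfl
    rw [h3]
    nlinarith [sq_nonneg ‖D t‖]
  rw [hm, hn]
  exact ENNReal.ofReal_le_ofReal (abs_le_of_sq_le_sq' hle hn0).2

/-! ### Uniqueness of Fourier coefficients in B¹ -/

/-- Weierstrass approximation of 1/max(√s, η), the cut-off at η making the target continuous at 0.
For a trigonometric polynomial P with |P| ≤ R, the product P·q(|P|²) is then again one, is bounded
by 2, and acts as the sign of P up to an error 2η. -/
lemma exists_polynomial_approx_inv_sqrt {R η : ℝ} (hR : 0 < R) (hη : 0 < η) :
    ∃ q : Polynomial ℝ, ∀ r, 0 ≤ r → r ≤ R →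
      r * |q.eval (r ^ 2)| ≤ 2 ∧ r - 2 * η ≤ r ^ 2 * q.eval (r ^ 2) := by
  -- The first term keeps r·δ ≤ 1 for the bound 2; the second keeps r²·δ ≤ η for the lower bound.
  set δ := min (1 / R) (η / R ^ 2)
  have hδ : 0 < δ := by positivity
  obtain ⟨q, hq⟩ := exists_polynomial_near_of_continuousOn 0 (R ^ 2)
    (fun s => 1 / max (√s) η) (Continuous.continuousOn (by
      refine continuous_const.div (by fun_prop) fun s => (lt_max_of_lt_right hη).ne')) δ hδ
  refine ⟨q, fun r hr hrR => ?_⟩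
  have h := hq (r ^ 2) ⟨by positivity, by gcongr⟩
  rw [Real.sqrt_sq hr] at h
  have hM : 0 < max r η := lt_max_of_lt_right hη
  have h1 : R * δ ≤ 1 := by
    calc R * δ ≤ R * (1 / R) := by gcongr; exact min_le_left _ _
      _ = 1 := by field_simp
  have h2 : R ^ 2 * δ ≤ η := by
    calc R ^ 2 * δ ≤ R ^ 2 * (η / R ^ 2) := by gcongr; exact min_le_right _ _
      _ = η := by field_simp
  obtain ⟨h3, h4⟩ := abs_lt.1 h
  have h5 : r * (1 / max r η) ≤ 1 := by
    rw [mul_one_div, div_le_one hM]; exact le_max_left _ _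
  have h6 : r - η ≤ r ^ 2 * (1 / max r η) := by
    rw [mul_one_div]
    rcases le_total r η with hle | hle
    · have : 0 ≤ r ^ 2 / max r η := by positivity
      linarith
    · rw [max_eq_left hle, sq, mul_self_div_self]; linarith
  constructor
  · have h7 : |q.eval (r ^ 2)| ≤ 1 / max r η + δ := by
      have : 0 < 1 / max r η := by positivity
      rw [abs_le]; constructor <;> linarith
    calc r * |q.eval (r ^ 2)| ≤ r * (1 / max r η + δ) := by gcongr
      _ = r * (1 / max r η) + r * δ := by ring
      _ ≤ 1 + R * δ := by gcongr
      _ ≤ 2 := by linarith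
  · have h8 : r ^ 2 * (1 / max r η - δ) ≤ r ^ 2 * q.eval (r ^ 2) := by
      gcongr; linarith
    have h9 : r ^ 2 * δ ≤ R ^ 2 * δ := by gcongr
    linarith

/-- A function of `B¹` all of whose Fourier coefficients vanish has vanishing seminorm. -/

lemma MemB.seminorm_one_eq_zero {h : ℝ → ℂ} (hh : MemB 1 h)
    (h0 : ∀ x, Tendsto (fun l => ∫ t, h t * wave (-x) t ∂avgMeasure l) atTop (𝓝 0)) :
    seminorm 1 h = 0 := by
  -- The 6η is η for `h - P` plus 5η for `P`: η from the mean of `h` against the test function, 2η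
  -- from `h - P` against it, and 2η from the imperfect sign.
  suffices H : ∀ η : ℝ, 0 < η → seminorm 1 h ≤ ENNReal.ofReal (6 * η) by
    refine le_antisymm (ENNReal.le_of_forall_pos_le_add fun ε hε _ => ?_) zero_le
    have := H (ε / 6) (by positivity)
    rwa [mul_div_cancel₀ _ (by norm_num), ENNReal.ofReal_coe_nnreal, ← zero_add (ε : ℝ≥0∞)] at this
  intro η hη
  obtain ⟨P, hP, hhP⟩ := hh.2 (ENNReal.ofReal η) (by simpa using hη)
  obtain ⟨R, hR, hPR⟩ := hP.exists_bound
  obtain ⟨q, hq⟩ := exists_polynomial_approx_inv_sqrt hR hη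
  -- A trigonometric substitute for P/|P|. Being a trigonometric polynomial, its conjugate has mean
  -- zero against `h`.
  set ψ : ℝ → ℂ := P * fun t => (q.map (algebraMap ℝ ℂ)).eval ((P * star P) t) with hψ
  have hψT : IsTrigPoly ψ := hP.mul ((hP.mul hP.star).polynomial_eval _)
  have hψeq : ∀ t, ψ t = P t * ((q.eval (‖P t‖ ^ 2) : ℝ) : ℂ) := by
    intro t
    have : (P * star P) t = algebraMap ℝ ℂ (‖P t‖ ^ 2) := by
      simp [Complex.mul_conj']
    rw [hψ, Pi.mul_apply, this, Polynomial.eval_map_algebraMap, Polynomial.aeval_algebraMap_apply]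
    rfl
  have hψb : ∀ t, ‖star (ψ t)‖ ≤ 2 := fun t => by
    rw [norm_star, hψeq, norm_mul, Complex.norm_real, Real.norm_eq_abs]
    exact (hq _ (norm_nonneg _) (hPR t)).1
  have hPψ : ∀ t, ‖P t‖ - 2 * η ≤ (P t * star (ψ t)).re := fun t => by
    have : P t * star (ψ t) = ((‖P t‖ ^ 2 * q.eval (‖P t‖ ^ 2) : ℝ) : ℂ) := by
      rw [hψeq, star_mul', ← mul_assoc, Complex.star_def, Complex.mul_conj']
      simp
    rw [this, Complex.ofReal_re]
    exact (hq _ (norm_nonneg _) (hPR t)).2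
  have hlim : Tendsto (fun l => ∫ t, h t * star (ψ t) ∂avgMeasure l) atTop (𝓝 0) := by
    obtain ⟨s, c, hsc⟩ := hψT
    have := tendsto_integral_mul_trigSum_star hh.eventually_integrable h0 s c
    rw [show ψ = trigSum s c from hsc]
    simpa using this
  rw [seminorm_one_eq]
  refine limsup_le_of_le (by isBoundedDefault) ?_
  filter_upwards [eventually_gt_atTop 0, hh.eventually_integrable, eventually_eLpNorm_one_lt hhP,
    Metric.tendsto_nhds.1 hlim η hη] with l hl h1 h2 h3
  have := isProbabilityMeasure_avgMeasure hl
  have hPi : Integrable P (avgMeasure l) := integrable_avgMeasure_of_continuous hP.continuous l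
  have hri : Integrable (fun t => h t - P t) (avgMeasure l) := h1.sub hPi
  have hψm : AEStronglyMeasurable (fun t => star (ψ t)) (avgMeasure l) :=
    hψT.star.continuous.aestronglyMeasurable
  have hPψi : Integrable (fun t => P t * star (ψ t)) (avgMeasure l) :=
    hPi.mul_bdd (c := 2) hψm (Eventually.of_forall hψb)
  have hhψi : Integrable (fun t => h t * star (ψ t)) (avgMeasure l) :=
    h1.mul_bdd (c := 2) hψm (Eventually.of_forall hψb)
  have h4 : ‖∫ t, (h t - P t) * star (ψ t) ∂avgMeasure l‖ ≤ 2 * η := by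
    refine (norm_integral_mul_le hri hψb).trans ?_
    gcongr
    exact ENNReal.toReal_le_of_le_ofReal hη.le h2.le
  have h5 : ∫ t, ‖P t‖ ∂avgMeasure l ≤ 5 * η := by
    have e1 : ∫ t, P t * star (ψ t) ∂avgMeasure l = ∫ t, h t * star (ψ t) ∂avgMeasure l -
        ∫ t, (h t - P t) * star (ψ t) ∂avgMeasure l := by
      simp only [sub_mul]
      rw [integral_sub hhψi hPψi, sub_sub_cancel]
    have e2 : ‖∫ t, P t * star (ψ t) ∂avgMeasure l‖ ≤ η + 2 * η := by
      rw [e1]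
      rw [dist_zero_right] at h3
      exact (norm_sub_le _ _).trans (add_le_add h3.le h4)
    have e3 : ∫ t, (‖P t‖ - 2 * η) ∂avgMeasure l ≤ (∫ t, P t * star (ψ t) ∂avgMeasure l).re := by
      rw [show (∫ t, P t * star (ψ t) ∂avgMeasure l).re =
        ∫ t, (P t * star (ψ t)).re ∂avgMeasure l from (integral_re hPψi).symm]
      exact integral_mono (hPi.norm.sub (integrable_const _)) hPψi.re hPψ
    rw [integral_sub hPi.norm (integrable_const _), integral_const] at e3
    simp only [probReal_univ, one_smul] at e3
    linarith [Complex.re_le_norm (∫ t, P t * star (ψ t) ∂avgMeasure l)]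
  have h6 : eLpNorm P 1 (avgMeasure l) ≤ ENNReal.ofReal (5 * η) := by
    rw [eLpNorm_one_eq_lintegral_enorm]
    rw [← ofReal_integral_norm_eq_lintegral_enorm hPi]
    exact ENNReal.ofReal_le_ofReal h5
  have h7 := eLpNorm_add_le hri.1 hPi.1 (le_refl 1)
  have e : (fun t => h t - P t) + P = h := by ext t; simp
  rw [e] at h7
  calc _ ≤ _ := h7
    _ ≤ ENNReal.ofReal η + ENNReal.ofReal (5 * η) := add_le_add h2.le h6
    _ = ENNReal.ofReal (6 * η) := by rw [← ENNReal.ofReal_add hη.le (by positivity)]; ring_nf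

/-! ### Completeness of B² -/

lemma eventually_lintegral_sq_le {F : ℝ → ℂ} {η : ℝ≥0∞} (h : seminorm 2 F < η) :
    ∀ᶠ l : ℝ in atTop,
      ∫⁻ t in Set.Icc (-l) l, ‖F t‖ₑ ^ (2 : ℝ) ≤ ENNReal.ofReal (2 * l) * η ^ (2 : ℝ) := by
  rw [seminorm, one_div, ENNReal.rpow_inv_lt_iff two_pos] at h
  filter_upwards [eventually_lt_of_limsup_lt h, eventually_gt_atTop 0] with l hl hl0
  rw [← setLIntegral_congr Ioc_ae_eq_Icc]
  have h2 : ENNReal.ofReal (2 * l) ≠ 0 := by simpa using hl0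
  rw [mul_comm, ← div_eq_mul_inv] at hl
  rw [mul_comm]
  exact (ENNReal.div_le_iff h2 ENNReal.ofReal_ne_top).1 hl.le

/-- Shell radii must exceed prescribed thresholds and grow geometrically, so that contributions of
earlier shells sum to a multiple of the last. The partial sums supply monotone majorants, the factor
2^k the doubling. -/
lemma exists_doubling_seq (T' : ℕ → ℝ) :
    ∃ T : ℕ → ℝ, (∀ k, T' k ≤ T k) ∧ (∀ k, 1 ≤ T k) ∧ ∀ k, 2 * T k ≤ T (k + 1) := by
  have hS : ∀ k, |T' k| + 1 ≤ ∑ i ∈ Finset.range (k + 1), (|T' i| + 1) := fun k =>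
    Finset.single_le_sum (f := fun i => |T' i| + 1) (fun i _ => by positivity)
      (Finset.mem_range.2 k.lt_succ_self)
  have hT : ∀ k, |T' k| + 1 ≤ 2 ^ k * ∑ i ∈ Finset.range (k + 1), (|T' i| + 1) := fun k =>
    (hS k).trans (le_mul_of_one_le_left (by positivity) (one_le_pow₀ one_le_two))
  refine ⟨fun k => 2 ^ k * ∑ i ∈ Finset.range (k + 1), (|T' i| + 1), fun k => ?_, fun k => ?_,
    fun k => ?_⟩
  · linarith [hT k, le_abs_self (T' k)]
  · linarith [hT k, abs_nonneg (T' k)]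
  · simp only
    rw [← mul_assoc, ← pow_succ', Finset.sum_range_succ _ (k + 1)]
    gcongr
    exact le_add_of_nonneg_right (by positivity)

/-- Completeness of `B²`: a Cauchy sequence of continuous functions has a limit, obtained by using
the `k`-th function on the shell `T k < |t| ≤ T (k + 1)`. -/

lemma exists_measurable_limit {G : ℕ → ℝ → ℂ} (hG : ∀ n, Continuous (G n)) {η : ℕ → ℝ≥0∞}
    (h : ∀ n m, n ≤ m → seminorm 2 (fun t => G m t - G n t) < η n) :
    ∃ g : ℝ → ℂ, Measurable g ∧ ∀ n, seminorm 2 (fun t => g t - G n t) ≤ 2 * η n := by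
  -- `T' k` is a radius beyond which `G k` satisfies the Cauchy bound against every earlier `G n` at
  -- once.
  have hev : ∀ k : ℕ, ∃ T' : ℝ, ∀ l, T' ≤ l → ∀ n ∈ Finset.range (k + 1),
      ∫⁻ t in Set.Icc (-l) l, ‖G k t - G n t‖ₑ ^ (2 : ℝ) ≤
        ENNReal.ofReal (2 * l) * η n ^ (2 : ℝ) := by
    intro k
    refine eventually_atTop.1 ((Filter.eventually_all_finset _).2 fun n hn => ?_)
    exact eventually_lintegral_sq_le (h n k (by simpa [Nat.lt_succ_iff] using hn))
  choose T' hT' using hev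
  obtain ⟨T, hTT', hT1, hT2⟩ := exists_doubling_seq T'
  have hstep : ∀ k l n, T k ≤ l → n ≤ k →
      ∫⁻ t in Set.Icc (-l) l, ‖G k t - G n t‖ₑ ^ (2 : ℝ) ≤
        ENNReal.ofReal (2 * l) * η n ^ (2 : ℝ) := fun k l n hl hn =>
    hT' k l ((hTT' k).trans hl) n (by simpa [Nat.lt_succ_iff] using hn)
  have hTmono : StrictMono T := strictMono_nat_of_lt_succ fun k => by
    linarith [hT1 k, hT2 k]
  have hTlim : Tendsto T atTop atTop := by
    refine tendsto_atTop_mono (fun k => ?_) tendsto_natCast_atTop_atTop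
    induction k with
    | zero => simpa using zero_le_one.trans (hT1 0)
    | succ k ih => push_cast; linarith [hT1 k, hT2 k]
  have hex : ∀ t : ℝ, ∃ k, |t| ≤ T (k + 1) := fun t =>
    ((hTlim.comp (tendsto_add_atTop_nat 1)).eventually_ge_atTop |t|).exists
  classical
  -- The least admissible index is used, so `G 0` also fills the central interval |t| ≤ `T 1`.
  set g : ℝ → ℂ := fun t => G (Nat.find (hex t)) t with hg
  have hgm : Measurable g := Measurable.find (fun n => (hG n).measurable)
    (fun n => measurableSet_le measurable_id.abs measurable_const) hex
  have hgk : ∀ k t, T k < |t| → |t| ≤ T (k + 1) → g t = G k t := by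
    intro k t h1 h2
    have : Nat.find (hex t) = k := by
      rw [Nat.find_eq_iff]
      exact ⟨h2, fun n hn => not_le.2 ((hTmono.monotone (Nat.succ_le_of_lt hn)).trans_lt h1)⟩
    simp only [hg, this]
  have hsplit : ∀ n k l, T k ≤ l → l ≤ T (k + 1) →
      ∫⁻ t in Set.Icc (-l) l, ‖g t - G n t‖ₑ ^ (2 : ℝ) ≤
        (∫⁻ t in Set.Icc (-T k) (T k), ‖g t - G n t‖ₑ ^ (2 : ℝ)) +
          ∫⁻ t in Set.Icc (-l) l, ‖G k t - G n t‖ₑ ^ (2 : ℝ) := by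
    intro n k l h1 h2
    have hsub : Set.Icc (-l) l ⊆
        Set.Icc (-T k) (T k) ∪ (Set.Icc (-l) l \ Set.Icc (-T k) (T k)) := by
      rw [Set.union_sdiff_self]; exact Set.subset_union_right
    refine (lintegral_mono_set hsub).trans ((lintegral_union_le _ _ _).trans ?_)
    gcongr 1
    have hm : MeasurableSet (Set.Icc (-l) l \ Set.Icc (-T k) (T k)) :=
      measurableSet_Icc.diff measurableSet_Icc
    rw [setLIntegral_congr_fun (g := fun t => ‖G k t - G n t‖ₑ ^ (2 : ℝ)) hm fun t ht => by
      have h3 : |t| ≤ l := abs_le.2 ht.1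
      have h4 : T k < |t| := not_le.1 fun hle => ht.2 (abs_le.1 hle)
      simp only [hgk k t h4 (h3.trans h2)]]
    exact lintegral_mono_set Set.sdiff_subset
  have hfin : ∀ n k l, ∫⁻ t in Set.Icc (-l) l, ‖G k t - G n t‖ₑ ^ (2 : ℝ) < ∞ := by
    intro n k l
    have := setLIntegral_lt_top_of_isCompact (μ := volume) (s := Set.Icc (-l) l)
      isCompact_Icc.measure_lt_top.ne isCompact_Icc (f := fun t => ‖G k t - G n t‖₊ ^ 2)
      (((hG k).sub (hG n)).nnnorm.pow 2)
    simpa [enorm_eq_nnnorm] using this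
  have hfin_g : ∀ n k, ∫⁻ t in Set.Icc (-T k) (T k), ‖g t - G n t‖ₑ ^ (2 : ℝ) < ∞ := by
    intro n k
    induction k with
    | zero =>
      have h0 : ∀ t ∈ Set.Icc (-T 0) (T 0), g t = G 0 t := fun t ht => by
        have : Nat.find (hex t) = 0 := by
          rw [Nat.find_eq_zero]
          exact (abs_le.2 ht).trans (hTmono.monotone (Nat.le_succ 0))
        simp only [hg, this]
      rw [setLIntegral_congr_fun (g := fun t => ‖G 0 t - G n t‖ₑ ^ (2 : ℝ)) measurableSet_Icc
        fun t ht => by simp only [h0 t ht]]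
      exact hfin n 0 _
    | succ k ih =>
      exact (hsplit n k _ (hTmono.monotone k.le_succ) le_rfl).trans_lt
        (ENNReal.add_lt_top.2 ⟨ih, hfin n k _⟩)
  refine ⟨g, hgm, fun n => ?_⟩
  set C := ∫⁻ t in Set.Icc (-T n) (T n), ‖g t - G n t‖ₑ ^ (2 : ℝ)
  -- The constant 4 is preserved by the induction: 4T k + 2T (k + 1) ≤ 4T (k + 1), by doubling.
  have hI : ∀ k, n ≤ k → ∫⁻ t in Set.Icc (-T k) (T k), ‖g t - G n t‖ₑ ^ (2 : ℝ) ≤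
      C + ENNReal.ofReal (4 * T k) * η n ^ (2 : ℝ) := by
    intro k hk
    induction k, hk using Nat.le_induction with
    | base => exact le_self_add
    | succ k hk ih =>
      have hle : T k ≤ T (k + 1) := hTmono.monotone k.le_succ
      refine (hsplit n k _ hle le_rfl).trans ((add_le_add ih (hstep k _ n hle hk)).trans ?_)
      rw [add_assoc, ← add_mul, ← ENNReal.ofReal_add (by linarith [hT1 k])
        (by linarith [hT1 (k + 1)])]
      gcongr
      linarith [hT2 k]
  -- For T k ≤ l the total factor is 4T k + 2l ≤ 3·(2l). The term `C` is finite and disappears after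
  -- division by 2l; finally 3 ≤ 2².
  have hbound : ∀ l, T n ≤ l → (ENNReal.ofReal (2 * l))⁻¹ *
      ∫⁻ t in Set.Ioc (-l) l, ‖g t - G n t‖ₑ ^ (2 : ℝ) ≤
        C * (ENNReal.ofReal (2 * l))⁻¹ + 3 * η n ^ (2 : ℝ) := by
    intro l hl
    obtain ⟨k, hk, hk1, hk2⟩ : ∃ k, n ≤ k ∧ T k ≤ l ∧ l ≤ T (k + 1) := by
      have hexl : ∃ k, l ≤ T (k + 1) :=
        ((hTlim.comp (tendsto_add_atTop_nat 1)).eventually_ge_atTop l).exists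
      rcases le_or_gt (Nat.find hexl) n with hle | hlt
      · exact ⟨n, le_rfl, hl, (Nat.find_spec hexl).trans (hTmono.monotone (by omega))⟩
      · refine ⟨Nat.find hexl, hlt.le, ?_, Nat.find_spec hexl⟩
        have := Nat.find_min hexl (m := Nat.find hexl - 1) (by omega)
        rw [Nat.sub_add_cancel (by omega)] at this
        exact (not_le.1 this).le
    have hl0 : 0 < l := by linarith [hT1 n]
    have h1 : ∫⁻ t in Set.Ioc (-l) l, ‖g t - G n t‖ₑ ^ (2 : ℝ) ≤
        C + ENNReal.ofReal (2 * l) * (3 * η n ^ (2 : ℝ)) := by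
      rw [setLIntegral_congr Ioc_ae_eq_Icc]
      refine (hsplit n k l hk1 hk2).trans ((add_le_add (hI k hk) (hstep k l n hk1 hk)).trans ?_)
      rw [add_assoc, ← add_mul, ← ENNReal.ofReal_add (by linarith [hT1 k]) (by linarith),
        ← mul_assoc, show (3 : ℝ≥0∞) = ENNReal.ofReal 3 by simp,
        ← ENNReal.ofReal_mul (by linarith)]
      gcongr
      linarith
    calc _ ≤ (ENNReal.ofReal (2 * l))⁻¹ * (C + ENNReal.ofReal (2 * l) * (3 * η n ^ (2 : ℝ))) := by
          gcongr
      _ = _ := by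
        rw [mul_add, ← mul_assoc, ENNReal.inv_mul_cancel (by simpa using hl0)
          ENNReal.ofReal_ne_top, one_mul, mul_comm C]
  have hlim : Tendsto (fun l : ℝ => C * (ENNReal.ofReal (2 * l))⁻¹ + 3 * η n ^ (2 : ℝ)) atTop
      (𝓝 (C * 0 + 3 * η n ^ (2 : ℝ))) := by
    refine (ENNReal.Tendsto.const_mul ?_ (Or.inr (hfin_g n n).ne)).add tendsto_const_nhds
    have : Tendsto (fun l : ℝ => ENNReal.ofReal (2 * l)) atTop (𝓝 ∞) :=
      ENNReal.tendsto_ofReal_atTop.comp (tendsto_id.const_mul_atTop two_pos)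
    simpa using tendsto_inv_iff.2 this
  have hls : limsup (fun l : ℝ => (ENNReal.ofReal (2 * l))⁻¹ *
      ∫⁻ t in Set.Ioc (-l) l, ‖g t - G n t‖ₑ ^ (2 : ℝ)) atTop ≤ 3 * η n ^ (2 : ℝ) := by
    rw [mul_zero, zero_add] at hlim
    rw [← hlim.limsup_eq]
    refine limsup_le_limsup ?_
    filter_upwards [eventually_ge_atTop (T n)] with l hl using hbound l hl
  rw [seminorm, one_div, ENNReal.rpow_inv_le_iff two_pos,
    ENNReal.mul_rpow_of_nonneg _ _ zero_le_two]
  refine hls.trans ?_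
  gcongr
  norm_num

/-! ### Kronecker's theorem and relatively dense solutions -/

/-- Expansion of the powers of `∑ e^{i(ψ(x) + xt)}`: the exponents and the moduli of the
coefficients do not depend on the additive phase `ψ`. -/

lemma exists_pow_eq_trigSum (s : Finset ℝ) (k : ℕ) :
    ∃ (S : Finset ℝ) (N : ℝ → ℕ), S.card ≤ (k + 1) ^ s.card ∧ ∑ y ∈ S, N y = s.card ^ k ∧
      ∀ (ψ : ℝ →+ ℝ) (t : ℝ), trigSum s (fun x => wave (ψ x) 1) t ^ k =
        trigSum S (fun y => N y * wave (ψ y) 1) t := by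
  classical
  let Λ : (Fin k → s) → ℝ := fun p => ∑ i, (p i : ℝ)
  -- The exponent of a word depends only on the multiplicities of its letters, each at most k. Hence
  -- the number of exponents is polynomial in k, although there are exponentially many words.
  let cnt : (Fin k → s) → (s → Fin (k + 1)) := fun p x =>
    ⟨(Finset.univ.filter fun i => p i = x).card,
      Nat.lt_succ_of_le ((Finset.card_filter_le _ _).trans (by simp))⟩
  have hΛ : ∀ p, Λ p = ∑ x : s, ((cnt p x : ℕ) : ℝ) * (x : ℝ) := by
    intro p
    have := Finset.sum_comp (s := Finset.univ) (fun x : s => (x : ℝ)) p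
    simp only [Λ, cnt, nsmul_eq_mul] at this ⊢
    rw [this]
    refine Finset.sum_subset (Finset.subset_univ _) fun x _ hx => ?_
    have : (Finset.univ.filter fun i => p i = x) = ∅ := by
      ext i
      simp only [Finset.mem_filter, Finset.mem_univ, true_and, Finset.notMem_empty, iff_false]
      exact fun hi => hx (Finset.mem_image.2 ⟨i, Finset.mem_univ _, hi⟩)
    simp [this]
  refine ⟨Finset.univ.image Λ, fun y => (Finset.univ.filter fun p => Λ p = y).card, ?_, ?_, ?_⟩
  · have h1 : Finset.univ.image Λ ⊆
        Finset.univ.image fun c : s → Fin (k + 1) => ∑ x : s, ((c x : ℕ) : ℝ) * (x : ℝ) := by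
      intro y hy
      obtain ⟨p, -, rfl⟩ := Finset.mem_image.1 hy
      exact Finset.mem_image.2 ⟨cnt p, Finset.mem_univ _, (hΛ p).symm⟩
    refine (Finset.card_le_card h1).trans (Finset.card_image_le.trans ?_)
    simp
  · rw [← Finset.card_eq_sum_card_image]
    simp
  · intro ψ t
    -- Additivity of `ψ` gives words with equal exponents equal phases, so they add up without
    -- cancellation.
    have hw : ∀ p : Fin k → s, ∏ i, (wave (ψ (p i)) 1 * wave (p i) t) =
        wave (ψ (Λ p)) 1 * wave (Λ p) t := by
      intro p
      simp only [Λ, map_sum, wave, Finset.prod_mul_distrib, ← Complex.exp_sum]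
      push_cast
      simp only [Finset.mul_sum, Finset.sum_mul]
    rw [trigSum, ← Finset.sum_coe_sort, Fintype.sum_pow, trigSum]
    simp only [hw]
    rw [Finset.sum_comp (fun y => wave (ψ y) 1 * wave y t) Λ]
    simp only [nsmul_eq_mul, mul_assoc]

/-- The supremum of `|∑ e^{i(ψ(x) + xt)}|` is the number of summands, for every additive `ψ`. -/

lemma exists_lt_norm_trigSum (s : Finset ℝ) (ψ : ℝ →+ ℝ) {r : ℝ} (hr : r < s.card) :
    ∃ t, r < ‖trigSum s (fun x => wave (ψ x) 1) t‖ := by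
  by_contra! H
  have hr0 : 0 ≤ r := (norm_nonneg _).trans (H 0)
  have hn : (0 : ℝ) < s.card := hr0.trans_lt hr
  -- If the sum F, with n terms, satisfied |F| ≤ r, Parseval for F^k and Cauchy–Schwarz would give
  -- n^{2k} ≤ (k + 1)^n r^{2k}, which fails for large k when r < n.
  have key : ∀ k : ℕ, (1 : ℝ) ≤ (k + 1 : ℕ) ^ s.card * ((r / s.card) ^ 2) ^ k := by
    intro k
    obtain ⟨S, N, hS, hN, hpow⟩ := exists_pow_eq_trigSum s k
    have h1 : ∑ y ∈ S, (N y : ℝ) ^ 2 ≤ (r ^ 2) ^ k := by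
      have h2 := tendsto_integral_norm_sq_trigSum S (fun y => N y * wave (ψ y) 1)
      simp only [norm_mul, norm_wave, mul_one, Complex.norm_natCast] at h2
      refine le_of_tendsto h2 ?_
      filter_upwards [eventually_gt_atTop 0] with l hl
      have := isProbabilityMeasure_avgMeasure hl
      have h3 : ∀ t, ‖trigSum S (fun y => N y * wave (ψ y) 1) t‖ ^ 2 ≤ (r ^ 2) ^ k := fun t => by
        rw [← hpow, norm_pow, ← pow_mul, ← pow_mul, mul_comm]
        gcongr
        exact H t
      have h4 := integral_mono (μ := avgMeasure l)
        (integrable_avgMeasure_of_continuous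
          ((isTrigPoly_trigSum S _).continuous.norm.pow 2) l) (integrable_const _) h3
      simpa using h4
    have h5 : ((s.card : ℝ) ^ k) ^ 2 ≤ (k + 1 : ℕ) ^ s.card * (r ^ 2) ^ k := by
      calc ((s.card : ℝ) ^ k) ^ 2 = (∑ y ∈ S, (N y : ℝ)) ^ 2 := by
            exact_mod_cast congrArg (· ^ 2) hN.symm
        _ ≤ S.card * ∑ y ∈ S, (N y : ℝ) ^ 2 := sq_sum_le_card_mul_sum_sq
        _ ≤ _ := by
          gcongr
          exact_mod_cast hS
    rw [div_pow, div_pow, ← pow_mul (s.card : ℝ), mul_comm 2 k, pow_mul, ← mul_div_assoc,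
      one_le_div (by positivity)]
    exact h5
  have hlt : (r / s.card) ^ 2 < 1 := by
    rw [sq_lt_one_iff₀ (by positivity), div_lt_one hn]; exact hr
  have hlim := tendsto_pow_const_mul_const_pow_of_abs_lt_one s.card
    (r := (r / s.card) ^ 2) (by rwa [abs_of_nonneg (by positivity)])
  by_cases h0 : r = 0
  · have := key 1
    norm_num [h0] at this
  have hq : (0 : ℝ) < (r / s.card) ^ 2 := by positivity
  -- The known limit concerns k^n q^k with equal indices; shifting k and multiplying `key` by q =
  -- (r/n)² aligns the two, whence the separate case r = 0.
  have hlim' := (hlim.comp (tendsto_add_atTop_nat 1)).eventually_lt_const hq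
  obtain ⟨k, hk⟩ := hlim'.exists
  have := mul_le_mul_of_nonneg_right (key k) hq.le
  simp only [Function.comp, pow_succ _ k] at hk
  rw [one_mul, mul_assoc] at this
  exact absurd hk (not_lt.2 this)

lemma norm_sub_one_sq_of_norm_one {z : ℂ} (hz : ‖z‖ = 1) : ‖z - 1‖ ^ 2 = 4 - ‖1 + z‖ ^ 2 := by
  have h1 := parallelogram_law_with_norm ℝ (1 : ℂ) z
  rw [norm_sub_rev 1 z, hz, norm_one] at h1
  linarith

/-- Kronecker's theorem. -/

lemma exists_norm_wave_sub_one_lt (s : Finset ℝ) (ψ : ℝ →+ ℝ) {δ : ℝ} (hδ : 0 < δ) :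
    ∃ t, ∀ x ∈ s, ‖wave (ψ x) 1 * wave x t - 1‖ < δ := by
  classical
  -- The exponent 0 contributes the constant 1, since ψ(0) = 0. A sum of unit vectors of nearly
  -- maximal modulus has them nearly aligned, and this term fixes their common direction.
  set s' := insert 0 s with hs'
  -- From |1 + z| > 2 - ρ ≥ 0 follows |z - 1|² < 4 - (2 - ρ)² ≤ 4ρ ≤ δ².
  set ρ := min 1 (δ ^ 2 / 4) with hρ
  have hρ0 : 0 < ρ := by positivity
  obtain ⟨t, ht⟩ := exists_lt_norm_trigSum s' ψ (r := s'.card - ρ) (by linarith)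
  refine ⟨t, fun x hx => ?_⟩
  by_cases hx0 : x = 0
  · simpa [hx0, wave_zero] using hδ
  set z : ℝ → ℂ := fun x => wave (ψ x) 1 * wave x t with hz
  have hz1 : ∀ x, ‖z x‖ = 1 := fun x => by simp [hz, norm_wave]
  have h0 : (0 : ℝ) ∈ s' := Finset.mem_insert_self _ _
  have hx' : x ∈ s'.erase 0 := Finset.mem_erase.2 ⟨hx0, Finset.mem_insert_of_mem hx⟩
  have hsum : trigSum s' (fun x => wave (ψ x) 1) t =
      ∑ y ∈ (s'.erase 0).erase x, z y + (1 + z x) := by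
    rw [trigSum, ← Finset.sum_erase_add _ _ h0, ← Finset.sum_erase_add _ _ hx']
    simp only [map_zero, wave_zero, Pi.one_apply, hz]
    ring
  have hcard : (((s'.erase 0).erase x).card : ℝ) = s'.card - 2 := by
    have h1 := Finset.card_erase_add_one hx'
    have h2 := Finset.card_erase_add_one h0
    have : ((s'.erase 0).erase x).card + 2 = s'.card := by omega
    rw [← this]; push_cast; ring
  have hle : ‖∑ y ∈ (s'.erase 0).erase x, z y‖ ≤ s'.card - 2 := by
    refine (norm_sum_le _ _).trans ?_
    simp only [hz1, Finset.sum_const, nsmul_eq_mul, mul_one, hcard, le_refl]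
  rw [hsum] at ht
  have h2 : 2 - ρ < ‖1 + z x‖ := by
    linarith [norm_add_le (∑ y ∈ (s'.erase 0).erase x, z y) (1 + z x)]
  have h3 : ‖z x - 1‖ ^ 2 < δ ^ 2 := by
    rw [norm_sub_one_sq_of_norm_one (hz1 x)]
    have h4 : ρ ≤ 1 := min_le_left _ _
    have h5 : ρ ≤ δ ^ 2 / 4 := min_le_right _ _
    nlinarith
  exact lt_of_pow_lt_pow_left₀ 2 hδ.le h3

/-- The solutions of the approximate congruences of Kronecker's theorem are relatively dense. -/

lemma exists_relatively_dense_norm_wave_sub_one_lt (s : Finset ℝ) (ψ : ℝ →+ ℝ) {δ : ℝ}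
    (hδ : 0 < δ) :
    ∃ L : ℝ, 0 < L ∧ ∀ a, ∃ t ∈ Set.Ico a (a + L),
      ∀ x ∈ s, ‖wave (ψ x) 1 * wave x t - 1‖ < δ := by
  obtain ⟨t₀, ht₀⟩ := exists_norm_wave_sub_one_lt s ψ (half_pos hδ)
  let u : ℝ → (s → ℂ) := fun t x => wave x t
  have hb : Bornology.IsBounded (Set.range u) := by
    refine isBounded_iff_forall_norm_le.2 ⟨1, ?_⟩
    rintro _ ⟨t, rfl⟩
    exact (pi_norm_le_iff_of_nonneg zero_le_one).2 fun x => (norm_wave _ _).le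
  -- Finitely many balls cover the curve `u`, and each ball that it meets gets a time `c y`, all
  -- bounded by |M|. Any time minus the `c y` of its ball is a δ/2-almost period; adding it to `t₀`
  -- gives a solution near any prescribed place.
  obtain ⟨F, hF⟩ := Metric.totallyBounded_iff.1 
    (hb.isCompact_closure.totallyBounded.subset subset_closure) (δ / 4) (by positivity)
  obtain ⟨hFfin, hcover⟩ := hF
  classical
  have hc : ∀ y : s → ℂ, ∃ t,
      (∃ t', u t' ∈ Metric.ball y (δ / 4)) → u t ∈ Metric.ball y (δ / 4) := by
    intro y
    by_cases h : ∃ t', u t' ∈ Metric.ball y (δ / 4)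
    · exact ⟨h.choose, fun _ => h.choose_spec⟩
    · exact ⟨0, fun h' => absurd h' h⟩
  choose c hc using hc
  obtain ⟨M, hM⟩ := (hFfin.image c).isBounded.exists_norm_le
  have hM' : ∀ y ∈ F, |c y| ≤ |M| := fun y hy =>
    (hM _ (Set.mem_image_of_mem c hy)).trans (le_abs_self M)
  refine ⟨2 * |M| + 1, by positivity, fun a => ?_⟩
  have hmem : u (a + |M| - t₀) ∈ ⋃ y ∈ F, Metric.ball y (δ / 4) := hcover ⟨_, rfl⟩
  obtain ⟨y, hy, hty⟩ := Set.mem_iUnion₂.1 hmem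
  have hcy := hc y ⟨_, hty⟩
  have hclose : dist (u (a + |M| - t₀)) (u (c y)) < δ / 2 := by
    rw [Metric.mem_ball] at hty hcy
    linarith [dist_triangle_right (u (a + |M| - t₀)) (u (c y)) y]
  obtain ⟨hc1, hc2⟩ := abs_le.1 (hM' y hy)
  refine ⟨a + |M| - c y, ⟨by linarith, by linarith⟩, fun x hx => ?_⟩
  have h1 : ‖wave x (a + |M| - t₀) - wave x (c y)‖ < δ / 2 := by
    have := (dist_le_pi_dist (u (a + |M| - t₀)) (u (c y)) ⟨x, hx⟩).trans_lt hclose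
    rwa [dist_eq_norm] at this
  have e1 : wave x (a + |M| - c y) =
      wave x (a + |M| - t₀) * wave x (-c y) * wave x t₀ := by
    rw [← wave_add_right, ← wave_add_right]; congr 1; ring
  have e2 : wave x (c y) * wave x (-c y) = 1 := by
    rw [← wave_add_right, add_neg_cancel, wave_zero_right]
  have e3 : wave (ψ x) 1 * wave x (a + |M| - c y) - 1 =
      (wave x (a + |M| - t₀) - wave x (c y)) * (wave x (-c y) * (wave (ψ x) 1 * wave x t₀)) +
        (wave (ψ x) 1 * wave x t₀ - 1) := by
    rw [e1]; linear_combination (wave (ψ x) 1 * wave x t₀) * e2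
  rw [e3]
  refine (norm_add_le _ _).trans_lt ?_
  rw [norm_mul, norm_mul, norm_mul, norm_wave, norm_wave, norm_wave, mul_one, mul_one, mul_one]
  linarith [ht₀ x hx]

/-! ### Satisfactorily uniform subsets -/

/-- Every relatively dense set of reals contains a satisfactorily uniform set of positive
numbers. -/

lemma exists_isSatisfactorilyUniform_subset {E : Set ℝ} {L : ℝ} (hL : 0 < L)
    (hE : ∀ a, ∃ t ∈ Set.Ico a (a + L), t ∈ E) :
    ∃ S ⊆ E, IsSatisfactorilyUniform S (Set.Ioi 0) := by
  -- One point per cell of length L, skipping the first cell for positivity. A window of length 4L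
  -- contains at least 3 whole cells and meets at most 5, and 5 < 2·3.
  choose σ hσ hσE using fun k : ℕ => hE ((k + 1 : ℕ) * L)
  have hlo : ∀ k : ℕ, (k + 1 : ℝ) * L ≤ σ k := fun k => by exact_mod_cast (hσ k).1
  have hhi : ∀ k : ℕ, σ k < (k + 2 : ℝ) * L := fun k => by
    have := (hσ k).2
    push_cast at this
    linarith
  have hσmono : StrictMono σ := strictMono_nat_of_lt_succ fun k => by
    have h1 := hhi k
    have h2 := hlo (k + 1)
    push_cast at h2
    linarith
  have hpos : ∀ k, 0 < σ k := fun k => lt_of_lt_of_le (by positivity) (hlo k)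
  refine ⟨Set.range σ, Set.range_subset_iff.2 hσE, Set.range_subset_iff.2 hpos, 4 * L,
    by positivity, ?_⟩
  have hfloor : ∀ a : {a : ℝ // Set.Ioo a (a + 4 * L) ⊆ Set.Ioi 0},
      ∃ j : ℕ, (j : ℝ) * L ≤ a ∧ (a : ℝ) < (j + 1) * L := by
    intro a
    have ha : 0 ≤ (a : ℝ) := by
      by_contra! hneg
      have hlt : (a : ℝ) < min 0 (a + 4 * L) := lt_min hneg (by linarith)
      obtain ⟨b, hb1, hb2⟩ := exists_between hlt
      exact absurd (a.2 ⟨hb1, hb2.trans_le (min_le_right _ _)⟩)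
        (not_lt.2 (hb2.le.trans (min_le_left _ _)))
    refine ⟨⌊(a : ℝ) / L⌋₊, ?_, ?_⟩
    · exact (le_div_iff₀ hL).1 (Nat.floor_le (by positivity))
    · exact (div_lt_iff₀ hL).1 (Nat.lt_floor_add_one _)
  have hmax : (⨆ a : {a : ℝ // Set.Ioo a (a + 4 * L) ⊆ Set.Ioi 0},
      (Set.range σ ∩ Set.Ioo (a : ℝ) (a + 4 * L)).encard) ≤ 5 := by
    refine iSup_le fun a => ?_
    obtain ⟨j, hj1, hj2⟩ := hfloor a
    have hsub : Set.range σ ∩ Set.Ioo (a : ℝ) (a + 4 * L) ⊆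
        σ '' (Finset.Icc (j - 1) (j + 3) : Finset ℕ) := by
      rintro _ ⟨⟨k, rfl⟩, hk1, hk2⟩
      refine ⟨k, ?_, rfl⟩
      have h1 : (j : ℝ) < (k + 2 : ℕ) := by
        have : (j : ℝ) * L < (k + 2) * L := by linarith [hhi k]
        exact_mod_cast lt_of_mul_lt_mul_right this hL.le
      have h2 : ((k + 1 : ℕ) : ℝ) < (j + 5 : ℕ) := by
        have : (k + 1 : ℝ) * L < (j + 5) * L := by linarith [hlo k]
        exact_mod_cast lt_of_mul_lt_mul_right this hL.le
      have h1' := Nat.cast_lt.1 h1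
      have h2' := Nat.cast_lt.1 h2
      simp only [Finset.coe_Icc, Set.mem_Icc]
      omega
    refine (Set.encard_le_encard hsub).trans ((Set.encard_image_le _ _).trans ?_)
    rw [Set.encard_coe_eq_coe_finsetCard, Nat.card_Icc]
    have : j + 3 + 1 - (j - 1) ≤ 5 := by omega
    exact_mod_cast this
  have hmin : 3 ≤ ⨅ a : {a : ℝ // Set.Ioo a (a + 4 * L) ⊆ Set.Ioi 0},
      (Set.range σ ∩ Set.Ioo (a : ℝ) (a + 4 * L)).encard := by
    refine le_iInf fun a => ?_
    obtain ⟨j, hj1, hj2⟩ := hfloor a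
    have hsub : σ '' (Finset.Icc j (j + 2) : Finset ℕ) ⊆
        Set.range σ ∩ Set.Ioo (a : ℝ) (a + 4 * L) := by
      rintro _ ⟨k, hk, rfl⟩
      simp only [Finset.coe_Icc, Set.mem_Icc] at hk
      refine ⟨⟨k, rfl⟩, ?_, ?_⟩
      · have : ((j : ℝ) + 1) * L ≤ (k + 1) * L := by
          gcongr; exact_mod_cast hk.1
        linarith [hlo k]
      · have : ((k : ℝ) + 2) * L ≤ (j + 4) * L := by
          have : ((k : ℕ) : ℝ) ≤ ((j + 2 : ℕ) : ℝ) := Nat.cast_le.2 hk.2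
          push_cast at this
          exact mul_le_mul_of_nonneg_right (by linarith) hL.le
        linarith [hhi k]
    refine le_trans ?_ (Set.encard_le_encard hsub)
    rw [hσmono.injective.encard_image, Set.encard_coe_eq_coe_finsetCard, Nat.card_Icc]
    have : 3 ≤ j + 2 + 1 - j := by omega
    exact_mod_cast this
  calc _ ≤ (5 : ℕ∞) := hmax
    _ < 2 * 3 := by decide
    _ ≤ _ := by gcongr

/-! ### Equivalent functions, approximation by translates, and the limit function -/

lemma HasFourierCoeff.tendsto {f : ℝ → ℂ} {x : ℝ} {a : ℂ} (h : HasFourierCoeff f x a) :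
    Tendsto (fun l => ∫ t, f t * wave (-x) t ∂avgMeasure l) atTop (𝓝 a) := by
  rw [tendsto_integral_avgMeasure_iff]
  simpa only [wave_neg] using h.2

/-- Equivalent functions have coefficient functions that differ on every finite set of exponents by
an additive phase. -/

lemma BohrEquiv.exists_coefficients {f₁ f : ℝ → ℂ} (h : BohrEquiv f₁ f) :
    ∃ A B : ℝ → ℂ, (∀ x, HasFourierCoeff f₁ x (A x)) ∧ (∀ x, HasFourierCoeff f x (B x)) ∧
      ∀ s : Finset ℝ, ∃ ψ : ℝ →+ ℝ, ∀ x ∈ s, B x = A x * wave (ψ x) 1 := by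
  classical
  obtain ⟨-, -, N, lam, a, b, -, ha, hb, hab⟩ := h
  let E : Set ℝ := {x | ∃ j : ℕ, (j : ℕ∞) < N ∧ lam j = x}
  have hidx : ∀ x, ∃ j : ℕ, x ∈ E → (j : ℕ∞) < N ∧ lam j = x := fun x => by
    by_cases hx : x ∈ E
    · exact ⟨hx.choose, fun _ => hx.choose_spec⟩
    · exact ⟨0, fun h => absurd h hx⟩
  choose idx hidx using hidx
  have hcoef : ∀ {k : ℝ → ℂ} {c : ℕ → ℂ}, HasFourierSeries k N lam c → ∀ x,
      HasFourierCoeff k x (if x ∈ E then c (idx x) else 0) := by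
    intro k c hk x
    split_ifs with hx
    · have := hk.1 _ (hidx x hx).1
      rwa [(hidx x hx).2] at this
    · exact hk.2 x fun j hj hjx => hx ⟨j, hj, hjx⟩
  refine ⟨_, _, hcoef ha, hcoef hb, fun s => ?_⟩
  -- `n` exceeds all indices of exponents in `s` but not `N`. For `n = 0` the equivalence gives no
  -- map, but then both coefficients vanish on `s`.
  set n := (s.filter (· ∈ E)).sup fun x => idx x + 1 with hn
  have hlt : ∀ x ∈ s, x ∈ E → idx x < n := fun x hx hxE =>
    Finset.le_sup (f := fun x => idx x + 1) (Finset.mem_filter.2 ⟨hx, hxE⟩)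
  have hnN : (n : ℕ∞) ≤ N := by
    rw [hn, Finset.apply_sup_eq_sup_comp (fun k : ℕ => (k : ℕ∞)) (fun x y => Nat.mono_cast.map_max)
      (by simp)]
    refine Finset.sup_le fun x hx => ?_
    have := (hidx x (Finset.mem_filter.1 hx).2).1
    simpa using Order.add_one_le_of_lt this
  rcases Nat.eq_zero_or_pos n with h0 | hpos
  · refine ⟨0, fun x hx => ?_⟩
    have hxE : x ∉ E := fun hxE => by have := hlt x hx hxE; omega
    simp [hxE]
  · obtain ⟨ψ, hψ⟩ := hab n hpos hnN
    -- Extending over ℚ from the span to all of ℝ yields the globally additive phase used in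
    -- Kronecker's theorem.
    obtain ⟨Ψ, hΨ⟩ := LinearMap.exists_extend ψ
    refine ⟨Ψ.toAddMonoidHom, fun x hx => ?_⟩
    by_cases hxE : x ∈ E
    · have h1 := hψ (idx x) (hlt x hx hxE)
      rw [← hΨ] at h1
      simp only [hxE, if_true, h1, wave]
      simp [(hidx x hxE).2]
    · simp [hxE]

/-- Three errors of ε/3: both functions are replaced by partial sums over one finite set,
independent of τ, and a Kronecker time τ brings the translated sum of `f` uniformly close to that of
`g`. -/
lemma exists_relatively_dense_seminorm_translate_sub_lt {f g : ℝ → ℂ} (hf : MemB 2 f)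
    (hg : MemB 2 g) {A B : ℝ → ℂ}
    (hB : ∀ x, Tendsto (fun l => ∫ t, f t * wave (-x) t ∂avgMeasure l) atTop (𝓝 (B x)))
    (hA : ∀ x, Tendsto (fun l => ∫ t, g t * wave (-x) t ∂avgMeasure l) atTop (𝓝 (A x)))
    (hAB : ∀ s : Finset ℝ, ∃ ψ : ℝ →+ ℝ, ∀ x ∈ s, B x = A x * wave (ψ x) 1) {ε : ℝ} (hε : 0 < ε) :
    ∃ L : ℝ, 0 < L ∧ ∀ a, ∃ τ ∈ Set.Ico a (a + L),
      seminorm 2 (fun t => f (t + τ) - g t) < ENNReal.ofReal ε := by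
  classical
  have hε3 : 0 < ENNReal.ofReal (ε / 3) := by simpa using hε
  obtain ⟨s₁, hs₁⟩ := hf.exists_seminorm_sub_trigSum_lt hB hε3
  obtain ⟨s₂, hs₂⟩ := hg.exists_seminorm_sub_trigSum_lt hA hε3
  set s := s₁ ∪ s₂
  obtain ⟨ψ, hψ⟩ := hAB s
  set K := ∑ x ∈ s, ‖A x‖ + 1 with hK
  have hKpos : 0 < K := by positivity
  obtain ⟨L, hL, hdense⟩ := exists_relatively_dense_norm_wave_sub_one_lt s ψ
    (δ := ε / 3 / K) (by positivity)
  refine ⟨L, hL, fun a => ?_⟩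
  obtain ⟨τ, hτ, hτs⟩ := hdense a
  refine ⟨τ, hτ, ?_⟩
  have hmid : ∀ t, ‖trigSum s B (t + τ) - trigSum s A t‖ ≤ ε / 3 := by
    intro t
    rw [trigSum_translate, trigSum_sub]
    calc ‖trigSum s (fun x => B x * wave x τ - A x) t‖
        ≤ ∑ x ∈ s, ‖(B x * wave x τ - A x) * wave x t‖ := norm_sum_le _ _
      _ ≤ ∑ x ∈ s, ‖A x‖ * (ε / 3 / K) := by
        refine Finset.sum_le_sum fun x hx => ?_
        have : B x * wave x τ - A x = A x * (wave (ψ x) 1 * wave x τ - 1) := by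
          rw [hψ x hx]; ring
        rw [norm_mul, norm_wave, mul_one, this, norm_mul]
        gcongr
        exact (hτs x hx).le
      _ = (K - 1) * (ε / 3 / K) := by rw [← Finset.sum_mul, hK]; ring
      _ ≤ K * (ε / 3 / K) := by gcongr; linarith
      _ = ε / 3 := by field_simp
  have hTB : IsTrigPoly fun t => trigSum s B (t + τ) := (isTrigPoly_trigSum s B).translate τ
  have hTA := isTrigPoly_trigSum s A
  have h1 : seminorm 2 (fun t => f (t + τ) - trigSum s B (t + τ)) < ENNReal.ofReal (ε / 3) :=
    (seminorm_translate_le two_pos (fun t => f t - trigSum s B t) τ).trans_lt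
      (hs₁ s Finset.subset_union_left)
  have h2 : seminorm 2 (fun t => trigSum s B (t + τ) - trigSum s A t) ≤ ENNReal.ofReal (ε / 3) :=
    seminorm_le_of_bound two_pos hmid
  have h3 : seminorm 2 (fun t => trigSum s A t - g t) < ENNReal.ofReal (ε / 3) := by
    rw [seminorm_sub_comm]
    exact hs₂ s Finset.subset_union_right
  have hfτ := (hf.translate two_pos τ).1
  calc seminorm 2 (fun t => f (t + τ) - g t)
      ≤ seminorm 2 (fun t => f (t + τ) - trigSum s B (t + τ)) +
        seminorm 2 (fun t => trigSum s B (t + τ) - g t) :=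
        seminorm_sub_le one_le_two hfτ hTB.aestronglyMeasurable hg.1
    _ ≤ seminorm 2 (fun t => f (t + τ) - trigSum s B (t + τ)) +
        (seminorm 2 (fun t => trigSum s B (t + τ) - trigSum s A t) +
          seminorm 2 (fun t => trigSum s A t - g t)) := by
        gcongr
        exact seminorm_sub_le one_le_two hTB.aestronglyMeasurable hTA.aestronglyMeasurable hg.1
    _ < ENNReal.ofReal (ε / 3) + (ENNReal.ofReal (ε / 3) + ENNReal.ofReal (ε / 3)) :=
        ENNReal.add_lt_add h1 (ENNReal.add_lt_add_of_le_of_lt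
          (h2.trans_lt ENNReal.ofReal_lt_top).ne h2 h3)
    _ = ENNReal.ofReal ε := by
        rw [← ENNReal.ofReal_add (by positivity) (by positivity),
          ← ENNReal.ofReal_add (by positivity) (by positivity)]
        ring_nf

/-- A coefficient function with the same moduli as that of a function of `B²` is itself the
coefficient function of a function of `B²`. -/

lemma exists_memB_two_of_norm_coeff_eq {f : ℝ → ℂ} (hf : MemB 2 f) {A B : ℝ → ℂ}
    (hB : ∀ x, Tendsto (fun l => ∫ t, f t * wave (-x) t ∂avgMeasure l) atTop (𝓝 (B x)))
    (hAB : ∀ x, ‖A x‖ = ‖B x‖) :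
    ∃ g, MemB 2 g ∧
      ∀ x, Tendsto (fun l => ∫ t, g t * wave (-x) t ∂avgMeasure l) atTop (𝓝 (A x)) := by
  classical
  have hpow : ∀ n : ℕ, (0 : ℝ≥0∞) < 2⁻¹ ^ n := fun n => ENNReal.pow_pos (by simp) n
  choose s' hs' using fun n => hf.exists_seminorm_sub_trigSum_lt hB (hpow n)
  set S : ℕ → Finset ℝ := fun n => (Finset.range (n + 1)).biUnion s'
  have hSmono : ∀ n m, n ≤ m → S n ⊆ S m := fun n m hnm =>
    Finset.biUnion_subset_biUnion_of_subset_left _ (Finset.range_mono (by omega))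
  have hsS : ∀ n, s' n ⊆ S n := fun n =>
    Finset.subset_biUnion_of_mem s' (Finset.mem_range.2 n.lt_succ_self)
  set η : ℕ → ℝ≥0∞ := fun n => 2⁻¹ ^ n + 2⁻¹ ^ n with hη
  have hcauchy : ∀ n s, S n ⊆ s →
      seminorm 2 (fun t => trigSum s A t - trigSum (S n) A t) < η n := by
    intro n s hs
    have hE : ∀ c : ℝ → ℂ, (fun t => trigSum s c t - trigSum (S n) c t) = trigSum (s \ S n) c :=
      fun c => funext fun t => trigSum_sub_trigSum_of_subset hs c t
    rw [hE, seminorm_two_trigSum]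
    -- The moduli agree, so the Cauchy estimate is transferred to the partial sums of `f`, which
    -- converge.
    simp only [hAB]
    rw [← seminorm_two_trigSum, ← hE]
    refine (seminorm_sub_le one_le_two (isTrigPoly_trigSum s B).aestronglyMeasurable hf.1
      (isTrigPoly_trigSum (S n) B).aestronglyMeasurable).trans_lt ?_
    rw [seminorm_sub_comm 2 (trigSum s B)]
    exact ENNReal.add_lt_add (hs' n s ((hsS n).trans hs)) (hs' n _ (hsS n))
  obtain ⟨g, hgm, hg⟩ := exists_measurable_limit
    (fun n => (isTrigPoly_trigSum (S n) A).continuous)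
    (fun n m hnm => hcauchy n (S m) (hSmono n m hnm))
  have hsmall : ∀ ε : ℝ≥0∞, 0 < ε → ∃ n, 2 * η n + η n < ε := by
    intro ε hε
    have h1 : Tendsto (fun n : ℕ => (2⁻¹ : ℝ≥0∞) ^ n) atTop (𝓝 0) :=
      ENNReal.tendsto_pow_atTop_nhds_zero_of_lt_one (by simp)
    have h2 : Tendsto η atTop (𝓝 0) := by simpa using h1.add h1
    have h3 : Tendsto (fun n => 2 * η n + η n) atTop (𝓝 0) := by
      simpa using (ENNReal.Tendsto.const_mul h2 (Or.inr (by simp))).add h2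
    exact (h3.eventually_lt_const hε).exists
  have hgB : MemB 2 g := by
    refine ⟨hgm.aestronglyMeasurable, fun ε hε => ?_⟩
    obtain ⟨n, hn⟩ := hsmall ε hε
    exact ⟨_, isTrigPoly_trigSum (S n) A, (hg n).trans_lt (le_self_add.trans_lt hn)⟩
  refine ⟨g, hgB, fun x => tendsto_integral_mul_wave_of_approx
    hgB.one_of_two.eventually_integrable fun ε hε => ?_⟩
  obtain ⟨n, hn⟩ := hsmall (ENNReal.ofReal ε) (by simpa using hε)
  -- Inserting `x` makes the coefficient at `x` exactly `A x`, whether or not `x` lies in `S n`.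
  have hT := isTrigPoly_trigSum (insert x (S n)) A
  refine ⟨trigSum (insert x (S n)) A, A x, (hT.memB one_pos).eventually_integrable, ?_, ?_,
    by simpa using hε⟩
  · refine (seminorm_one_le_two (hgB.1.sub hT.aestronglyMeasurable)).trans_lt
      (lt_of_le_of_lt ?_ hn)
    refine (seminorm_sub_le one_le_two hgB.1
      (isTrigPoly_trigSum (S n) A).aestronglyMeasurable hT.aestronglyMeasurable).trans
      (add_le_add (hg n) ?_)
    rw [seminorm_sub_comm]
    exact (hcauchy n _ (Finset.subset_insert _ _)).le
  · simpa using tendsto_integral_trigSum_mul_wave_neg (insert x (S n)) A x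

lemma tendsto_coeff_of_seminorm_one_sub_eq_zero {f g : ℝ → ℂ} (hf : MemB 1 f) (hg : MemB 1 g)
    (h : seminorm 1 (fun t => f t - g t) = 0) {x : ℝ} {a : ℂ}
    (ha : Tendsto (fun l => ∫ t, f t * wave (-x) t ∂avgMeasure l) atTop (𝓝 a)) :
    Tendsto (fun l => ∫ t, g t * wave (-x) t ∂avgMeasure l) atTop (𝓝 a) := by
  refine tendsto_integral_mul_wave_of_approx hg.eventually_integrable fun ε hε =>
    ⟨f, a, hf.eventually_integrable, ?_, ha, by simpa using hε⟩
  rw [seminorm_sub_comm, h]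
  simpa using hε

lemma exists_strictMono_seq_of_relatively_dense {φ : ℝ → ℝ≥0∞}
    (h : ∀ ε : ℝ, 0 < ε → ∀ a, ∃ τ, a ≤ τ ∧ φ τ < ENNReal.ofReal ε) :
    ∃ τ : ℕ → ℝ, StrictMono τ ∧ (∀ n, 0 < τ n) ∧ Tendsto τ atTop atTop ∧
      Tendsto (fun n => φ (τ n)) atTop (𝓝 0) := by
  choose σ hσ hσφ using fun n : ℕ => h (1 / (n + 1)) (by positivity)
  -- Each term is sought beyond the previous one plus 1, starting from 1; this forces τ n ≥ n + 1.
  let τ : ℕ → ℝ := fun n => Nat.rec (σ 0 1) (fun k r => σ (k + 1) (r + 1)) n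
  have hτs : ∀ n, τ n + 1 ≤ τ (n + 1) := fun n => hσ (n + 1) (τ n + 1)
  have hτn : ∀ n : ℕ, (n : ℝ) + 1 ≤ τ n := by
    intro n
    induction n with
    | zero => simpa [τ] using hσ 0 1
    | succ n ih => push_cast; linarith [hτs n]
  have hτφ : ∀ n : ℕ, φ (τ n) ≤ ENNReal.ofReal (1 / (n + 1)) := by
    intro n
    cases n with
    | zero => exact (hσφ 0 1).le
    | succ n => exact (hσφ (n + 1) (τ n + 1)).le
  refine ⟨τ, strictMono_nat_of_lt_succ fun n => by linarith [hτs n],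
    fun n => lt_of_lt_of_le (by positivity) (hτn n),
    tendsto_atTop_mono (fun n => by linarith [hτn n]) tendsto_natCast_atTop_atTop, ?_⟩
  refine tendsto_of_tendsto_of_tendsto_of_le_of_le tendsto_const_nhds ?_ (fun _ => zero_le) hτφ
  simpa using ENNReal.tendsto_ofReal (tendsto_one_div_add_atTop_nhds_zero_nat (𝕜 := ℝ))

end Besicovitch

theorem mainTheorem4 (f f₁ : ℝ → ℂ) (hf : Besicovitch.MemB 2 f)
    (hf₁ : Besicovitch.BohrEquiv f₁ f) :
    -- the element of `B(ℝ, ℂ)` represented by `f₁` lies in `B²(ℝ, ℂ)`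
    (∃ g : ℝ → ℂ, Besicovitch.MemB 2 g ∧ Besicovitch.seminorm 1 (fun t => f₁ t - g t) = 0) ∧
    -- and for every function `g` of `B²(ℝ, ℂ)` representing it (`g = f₁` if `f₁` is in `B²`):
    ∀ g : ℝ → ℂ, Besicovitch.MemB 2 g →
      Besicovitch.seminorm 1 (fun t => f₁ t - g t) = 0 →
      (∃ τ : ℕ → ℝ, StrictMono τ ∧ (∀ n, 0 < τ n) ∧ Tendsto τ atTop atTop ∧
        Tendsto (fun n => Besicovitch.seminorm 2 (fun t => f (t + τ n) - g t)) atTop (𝓝 0)) ∧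
      (∀ ε : ℝ, 0 < ε → ∃ S : Set ℝ, Besicovitch.IsSatisfactorilyUniform S (Set.Ioi 0) ∧
        ∀ τ ∈ S, ∃ m : ℝ,
          Besicovitch.HasMean (fun t => ‖f (t + τ) - g t‖ ^ 2) m ∧ m < ε) := by
  obtain ⟨A, B, hA, hB, hAB⟩ := hf₁.exists_coefficients
  have hB' := fun x => (hB x).tendsto
  refine ⟨?_, fun g hg hfg => ?_⟩
  · have hnorm : ∀ x, ‖A x‖ = ‖B x‖ := fun x => by
      obtain ⟨ψ, hψ⟩ := hAB {x}
      rw [hψ x (Finset.mem_singleton_self x), norm_mul, Besicovitch.norm_wave, mul_one]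
    obtain ⟨g, hg, hgA⟩ := Besicovitch.exists_memB_two_of_norm_coeff_eq hf hB' hnorm
    refine ⟨g, hg, (hf₁.1.sub le_rfl hg.one_of_two).seminorm_one_eq_zero fun x => ?_⟩
    have hlim := (hA x).tendsto.sub (hgA x)
    rw [sub_self] at hlim
    refine hlim.congr' ?_
    filter_upwards [hf₁.1.eventually_integrable, hg.one_of_two.eventually_integrable] with l h1 h2
    have hb : ∀ {q : ℝ → ℂ}, Integrable q (Besicovitch.avgMeasure l) →
        Integrable (fun t => q t * Besicovitch.wave (-x) t) (Besicovitch.avgMeasure l) :=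
      fun hq => hq.mul_bdd (c := 1) (Besicovitch.continuous_wave _).aestronglyMeasurable
        (Eventually.of_forall fun t => (Besicovitch.norm_wave _ t).le)
    rw [← integral_sub (hb h1) (hb h2)]
    simp only [sub_mul]
  · have hgA := fun x => Besicovitch.tendsto_coeff_of_seminorm_one_sub_eq_zero hf₁.1 hg.one_of_two
      hfg (hA x).tendsto
    have hdense := fun ε hε => Besicovitch.exists_relatively_dense_seminorm_translate_sub_lt
      hf hg hB' hgA hAB (ε := ε) hε
    constructor
    · refine Besicovitch.exists_strictMono_seq_of_relatively_dense
        (φ := fun τ => Besicovitch.seminorm 2 (fun t => f (t + τ) - g t)) fun ε hε a => ?_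
      obtain ⟨L, -, hL⟩ := hdense ε hε
      obtain ⟨τ, hτ, hτε⟩ := hL a
      exact ⟨τ, hτ.1, hτε⟩
    · intro ε hε
      -- The seminorm is the square root of the quadratic mean, hence √ε.
      obtain ⟨L, hL, hLd⟩ := hdense (√ε) (Real.sqrt_pos.2 hε)
      obtain ⟨S, hSE, hS⟩ := Besicovitch.exists_isSatisfactorilyUniform_subset
        (E := {τ | Besicovitch.seminorm 2 (fun t => f (t + τ) - g t) < ENNReal.ofReal (√ε)}) hL hLd
      exact ⟨S, hS, fun τ hτ => ((hf.translate two_pos τ).sub one_le_two hg).exists_hasMean_norm_sq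
        (hSE hτ)⟩
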